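/- Let $I\subseteq\mathbb R$ be a non-degenerate interval (open, closed or half-open, bounded or not, containing $0$ or not), let $M=(M_n)_{n\ge 0}$ be a sequence of positive real numbers, and let $0\le a<1$. Let $C^M_a(I)$ be the class of all real-valued (respectively, complex-valued) functions $g\in C^\infty(I)$ such that for every compact set $K\subset I$ there exist constants $A,B>0$ with $$|g^{(n)}(x)|\le A B^n\frac{M_n}{|x|^{an}},\qquad x\in K\setminus\{0\},\ n\ge 0$$ (derivatives at an endpoint belonging to $I$ are one-sided). Call the class $C^M_a(I)$ quasianalytic if every $g\in C^M_a(I)$ such that, for some $x\in I$, $g^{(n)}(x)=0$ for all $n\ge0$, is identically zero on $I$. Let $$M^C_n=\min\Bigl\{M_n,\ \inf_{j<n<\ell} M_j^{(\ell-n)/(\ell-j)}M_\ell^{(n-j)/(\ell-j)}\Bigr\}$$ be the largest log-convex minorant of $M$ (for $n=0$ the infimum is over the empty set, and $M^C_0=M_0$). Suppose that $M$ is log-convex, i.e. $M_{n+1}^2\le M_nM_{n+2}$ for all $n\ge0$, or that the sequence $(M_n/n!)_{n\ge0}$ is non-decreasing. Then, both for real-valued and for complex-valued functions, the class $C^M_a(I)$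 is quasianalytic if and only if $$\sum_{n\ge0}\frac{M^C_n}{M^C_{n+1}}=\infty .$$ -/

import Mathlib

open scoped ContDiff

/-- Logarithmic convexity of a (positive) sequence. -/
def IsLogConvexSeq (M : ℕ → ℝ) : Prop :=
  ∀ n : ℕ, M (n + 1) ^ 2 ≤ M n * M (n + 2)

/-- The largest log-convex minorant `M^C` of a positive sequence `M`:
`M^C_n = min {M_n, inf_{j < n < l} M_j ^ ((l - n) / (l - j)) * M_l ^ ((n - j) / (l - j))}`.
The minimum and the infimum are taken together, as the infimum of one nonempty set of positive
numbers; thus `M^C_0 = M_0`, where there is no `j < 0`. -/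
noncomputable def logConvexMinorant (M : ℕ → ℝ) (n : ℕ) : ℝ :=
  sInf ({M n} ∪ {y : ℝ | ∃ j l : ℕ, j < n ∧ n < l ∧
    y = M j ^ (((l : ℝ) - n) / ((l : ℝ) - j)) * M l ^ (((n : ℝ) - j) / ((l : ℝ) - j))})

/-- The Denjoy-Carleman condition: the series `∑ M^C_n / M^C_{n+1}` diverges to infinity. -/
def DenjoyCarlemanCondition (M : ℕ → ℝ) : Prop :=
  Filter.Tendsto
    (fun N : ℕ => ∑ n ∈ Finset.range N, logConvexMinorant M n / logConvexMinorant M (n + 1))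
    Filter.atTop Filter.atTop

/-- The non-homogeneous Carleman class `C^M_a(I)`. Smoothness and derivatives are taken within
`I` (one-sided at an endpoint of `I` that belongs to `I`). Only the values on `I` matter. -/
def carlemanClass (𝕜 : Type*) [RCLike 𝕜] (M : ℕ → ℝ) (a : ℝ) (I : Set ℝ) : Set (ℝ → 𝕜) :=
  {g | ContDiffOn ℝ ∞ g I ∧
    ∀ K : Set ℝ, K ⊆ I → IsCompact K →
      ∃ A B : ℝ, 0 < A ∧ 0 < B ∧ ∀ x ∈ K \ {0}, ∀ n : ℕ,
        ‖iteratedDerivWithin n g I x‖ ≤ A * B ^ n * (M n / |x| ^ (a * (n : ℝ)))}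

/-- A class of functions on `I` is quasianalytic if every member with zero formal Taylor
expansion at some point of `I` vanishes identically on `I`. -/
def IsQuasianalytic {𝕜 : Type*} [RCLike 𝕜] (I : Set ℝ) (C : Set (ℝ → 𝕜)) : Prop :=
  ∀ f ∈ C, (∃ x ∈ I, ∀ n : ℕ, iteratedDerivWithin n f I x = 0) → ∀ y ∈ I, f y = 0

/-!
Sufficiency of the Denjoy-Carleman condition rests on Bang's argument. Let `W` be the log-convex
minorant of `M` and let all derivatives of `f` vanish at `0`. Say that `f` has order `p` at `x` if
`|f⁽ʲ⁾ x| ≤ e ^ (j - p) A B^j W_j` for `j ≤ p`. If `p < l` are consecutive points of contact of `M`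
with `W`, an order `l` at `x` implies an order `p` on `[x, x + h]`, where `h` is `1 / (e B)` times
the sum of `W_n / W_{n+1}` over `p ≤ n < l` (`bang_step`): the ratio `W_{n+1} / W_n` is constant
there, and the bound on the derivative of order `l` closes the estimate. As the series diverges and
`f` has all orders at `0`, it has all orders at every point, hence vanishes
(`eq_zero_of_denjoyCarleman`). Only bounds at the points of contact are used, so `M` need not be
log-convex. That there are infinitely many such points follows from `M n ≥ M 0 * n!`
(`exists_contact_sequence`). A log-convex `M` can be enlarged so that `M n / n!` is non-decreasing
without losing the divergence (`IsLogConvexSeq.exists_le_monotone_div_factorial`).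

The weight `|x| ^ (-a n)` matters only at the origin. If all derivatives of `g` vanish at `0`,
take an integer `k` large enough that `a < 1 - 1 / k` with room to spare, and put
`h t = g (t ^ k)`. The derivative of order `m` of `h` is a sum of the terms
`P_{m,j} t ^ (k j - m) g⁽ʲ⁾ (t ^ k)` with `m / k ≤ j ≤ m`. Integrating the bound for `g⁽ᵐ⁾` from a
fixed point `m - j` times gives `|g⁽ʲ⁾ x| ≤ A C^m M_m / (m - j)! * x ^ (m / k - j)`; here the
monotonicity of `M n / n!` takes care of the boundary terms
(`norm_le_of_norm_iterated_deriv_le`). Since `P_{m,j} ≤ (2 k)^m m! / j!`, the powers of `t` cancel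
and `|h⁽ᵐ⁾| ≤ A C^m M_m`: the weight is gone, and the unweighted theorem gives `g = 0` near the
origin (`eq_zero_of_denjoyCarleman_of_weight`).

For necessity, if `∑ W_n / W_{n+1}` converges, the indicator of `(0, ∞)` is averaged successively
over windows of lengths `a_n = c W_n / W_{n+1}`. The limit is smooth, vanishes on `(-∞, 0]`, equals
`1` beyond `∑ a_n`, and its derivative of order `n` is at most `∏ 2 / a_i = (2 / c)^n W_n / W_0`
(`abs_iteratedDeriv_infiniteAverage_le`). On a compact set the weight is bounded below by a
geometric progression, so a translate of this function is in the class
(`not_isQuasianalytic_of_summable`).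
-/

/-! ### The largest log-convex minorant -/

section Minorant

variable {M : ℕ → ℝ}

lemma logConvexMinorant_bddBelow (hM : ∀ n, 0 < M n) (n : ℕ) :
    BddBelow ({M n} ∪ {y : ℝ | ∃ j l : ℕ, j < n ∧ n < l ∧
      y = M j ^ (((l : ℝ) - n) / ((l : ℝ) - j)) * M l ^ (((n : ℝ) - j) / ((l : ℝ) - j))}) := by
  refine ⟨0, ?_⟩
  rintro y (rfl | ⟨j, l, -, -, rfl⟩)
  · exact (hM n).le
  · exact mul_nonneg (Real.rpow_nonneg (hM j).le _) (Real.rpow_nonneg (hM l).le _)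

lemma logConvexMinorant_le (hM : ∀ n, 0 < M n) (n : ℕ) : logConvexMinorant M n ≤ M n :=
  csInf_le (logConvexMinorant_bddBelow hM n) (Or.inl rfl)

lemma geometric_interpolation {K r : ℝ} (hK : 0 < K) (hr : 0 < r) {j n l : ℕ} (hjn : j < n)
    (hnl : n < l) :
    (K * r ^ j) ^ (((l : ℝ) - n) / ((l : ℝ) - j)) * (K * r ^ l) ^ (((n : ℝ) - j) / ((l : ℝ) - j))
      = K * r ^ n := by
  have h1 : (j : ℝ) < n := by exact_mod_cast hjn
  have h2 : (n : ℝ) < l := by exact_mod_cast hnl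
  have h3 : (l : ℝ) - j ≠ 0 := by linarith
  rw [Real.mul_rpow hK.le (pow_nonneg hr.le _), Real.mul_rpow hK.le (pow_nonneg hr.le _),
    ← Real.rpow_natCast r j, ← Real.rpow_natCast r l, ← Real.rpow_natCast r n,
    ← Real.rpow_mul hr.le, ← Real.rpow_mul hr.le, mul_mul_mul_comm, ← Real.rpow_add hK,
    ← Real.rpow_add hr]
  have e1 : ((l : ℝ) - n) / ((l : ℝ) - j) + ((n : ℝ) - j) / ((l : ℝ) - j) = 1 := by
    field_simp; ring
  have e2 : (j : ℝ) * (((l : ℝ) - n) / ((l : ℝ) - j)) + l * (((n : ℝ) - j) / ((l : ℝ) - j)) = n := by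
    field_simp; ring
  rw [e1, e2, Real.rpow_one]

/-- The minorant lies above every geometric progression lying below `M`. -/
lemma geometric_le_logConvexMinorant {K r : ℝ} (hK : 0 < K) (hr : 0 < r)
    (h : ∀ j, K * r ^ j ≤ M j) (n : ℕ) : K * r ^ n ≤ logConvexMinorant M n := by
  refine le_csInf ⟨M n, Or.inl rfl⟩ ?_
  rintro y (rfl | ⟨j, l, hj, hl, rfl⟩)
  · exact h n
  · have h1 : (j : ℝ) < n := by exact_mod_cast hj
    have h2 : (n : ℝ) < l := by exact_mod_cast hl
    rw [← geometric_interpolation hK hr hj hl]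
    have e1 : 0 ≤ ((l : ℝ) - n) / ((l : ℝ) - j) := div_nonneg (by linarith) (by linarith)
    have e2 : 0 ≤ ((n : ℝ) - j) / ((l : ℝ) - j) := div_nonneg (by linarith) (by linarith)
    have p1 : 0 < K * r ^ j := by positivity
    have p2 : 0 < K * r ^ l := by positivity
    exact mul_le_mul (Real.rpow_le_rpow p1.le (h j) e1) (Real.rpow_le_rpow p2.le (h l) e2)
      (Real.rpow_nonneg p2.le _) (Real.rpow_nonneg (p1.le.trans (h j)) _)

/-- Between two points of contact with `M`, a geometric progression below `M` is the minorant. -/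
lemma logConvexMinorant_eq_geometric (hM : ∀ n, 0 < M n) {K r : ℝ} (hK : 0 < K) (hr : 0 < r)
    (h : ∀ j, K * r ^ j ≤ M j) {p l : ℕ} (hp : M p = K * r ^ p) (hl : M l = K * r ^ l) {n : ℕ}
    (hpn : p ≤ n) (hnl : n ≤ l) : logConvexMinorant M n = K * r ^ n := by
  refine le_antisymm ?_ (geometric_le_logConvexMinorant hK hr h n)
  rcases hpn.eq_or_lt with rfl | hpn
  · exact hp ▸ logConvexMinorant_le hM p
  rcases hnl.eq_or_lt with rfl | hnl
  · exact hl ▸ logConvexMinorant_le hM n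
  · refine csInf_le (logConvexMinorant_bddBelow hM n) (Or.inr ⟨p, l, hpn, hnl, ?_⟩)
    rw [hp, hl, geometric_interpolation hK hr hpn hnl]

lemma IsLogConvexSeq.ratio_monotone (hM : ∀ n, 0 < M n) (h : IsLogConvexSeq M) :
    Monotone fun n => M (n + 1) / M n := by
  refine monotone_nat_of_le_succ fun n => ?_
  rw [div_le_div_iff₀ (hM _) (hM _)]
  have := h n
  nlinarith

lemma IsLogConvexSeq.tangent_le (hM : ∀ n, 0 < M n) (h : IsLogConvexSeq M) (n j : ℕ) :
    M n * (M (n + 1) / M n) ^ j ≤ M j * (M (n + 1) / M n) ^ n := by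
  set r := M (n + 1) / M n with hr
  have hr0 : 0 < r := div_pos (hM _) (hM _)
  have hmono := h.ratio_monotone hM
  rcases le_total n j with hj | hj
  · induction j, hj using Nat.le_induction with
    | base => exact le_rfl
    | succ j hj ih =>
      have h1 : r ≤ M (j + 1) / M j := hmono hj
      rw [le_div_iff₀ (hM j)] at h1
      calc M n * r ^ (j + 1) = (M n * r ^ j) * r := by ring
        _ ≤ (M j * r ^ n) * r := by gcongr
        _ = (r * M j) * r ^ n := by ring
        _ ≤ _ := by gcongr
  · induction hj using Nat.decreasingInduction with
    | self => exact le_rfl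
    | of_succ j hj ih =>
      have h1 : M (j + 1) / M j ≤ r := hmono hj.le
      rw [div_le_iff₀ (hM j)] at h1
      have : (M n * r ^ j) * r ≤ (M j * r ^ n) * r := by
        calc (M n * r ^ j) * r = M n * r ^ (j + 1) := by ring
          _ ≤ M (j + 1) * r ^ n := ih
          _ ≤ (r * M j) * r ^ n := by gcongr
          _ = _ := by ring
      exact le_of_mul_le_mul_right this hr0

lemma IsLogConvexSeq.logConvexMinorant_eq (hM : ∀ n, 0 < M n) (h : IsLogConvexSeq M) :
    logConvexMinorant M = M := by
  funext n
  have hr0 : 0 < M (n + 1) / M n := div_pos (hM _) (hM _)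
  set r := M (n + 1) / M n with hr
  refine le_antisymm (logConvexMinorant_le hM n) ?_
  have := geometric_le_logConvexMinorant (M := M) (K := M n / r ^ n) (r := r)
    (div_pos (hM n) (pow_pos hr0 n)) hr0 (fun j => by
      rw [div_mul_eq_mul_div, div_le_iff₀ (pow_pos hr0 n)]
      exact h.tangent_le hM n j) n
  rwa [div_mul_cancel₀ _ (pow_pos hr0 n).ne'] at this

lemma mul_factorial_le_of_monotone (hmono : Monotone fun n : ℕ => M n / (n.factorial : ℝ))
    (n : ℕ) : M 0 * n.factorial ≤ M n := by
  have := hmono (Nat.zero_le n)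
  simp only [Nat.factorial_zero, Nat.cast_one, div_one] at this
  rwa [le_div_iff₀ (by positivity)] at this

/-- A supporting geometric progression of `M` at `p` with ratio `r` can be tilted around `p` until
it touches `M` again at some `l > p`. -/
lemma exists_next_contact (hM : ∀ n, 0 < M n)
    (hmono : Monotone fun n : ℕ => M n / (n.factorial : ℝ)) {p : ℕ} {r : ℝ} (hr : 0 < r)
    (h : ∀ j, M p * r ^ j ≤ M j * r ^ p) :
    ∃ l r', p < l ∧ r ≤ r' ∧ (∀ j, M p * r' ^ j ≤ M j * r' ^ p) ∧ M p * r' ^ l = M l * r' ^ p := by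
  set ρ : ℕ → ℝ := fun s => (M (p + 1 + s) / M p) ^ (((s : ℝ) + 1)⁻¹) with hρ
  have hbase : ∀ s, 0 < M (p + 1 + s) / M p := fun s => div_pos (hM _) (hM _)
  have hρ0 : ∀ s, 0 < ρ s := fun s => Real.rpow_pos_of_pos (hbase s) _
  have hpow : ∀ s, ρ s ^ (s + 1) = M (p + 1 + s) / M p := fun s => by
    have := Real.rpow_inv_natCast_pow (hbase s).le (Nat.succ_ne_zero s)
    simpa [hρ] using this
  -- The slopes of the chords starting at `p` tend to infinity since `M n ≥ M 0 * n!`.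
  have htend : Filter.Tendsto ρ Filter.atTop Filter.atTop := by
    rw [Filter.tendsto_atTop]
    intro R
    have hR : 0 < max R 1 := lt_of_lt_of_le one_pos (le_max_right _ _)
    set R' := max R 1
    have h0 := FloorSemiring.tendsto_pow_div_factorial_atTop R'
    have hc : 0 < M 0 * R' ^ p / M p := by have := hM 0; have := hM p; positivity
    have h1 := (Filter.tendsto_add_atTop_iff_nat (p + 1)).2 h0
    filter_upwards [h1.eventually (gt_mem_nhds hc)] with s hs
    have e : s + (p + 1) = p + 1 + s := by ring
    rw [e, div_lt_div_iff₀ (by positivity) (hM p)] at hs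
    have h2 := mul_factorial_le_of_monotone hmono (p + 1 + s)
    refine (le_max_left R 1).trans (le_of_lt (lt_of_pow_lt_pow_left₀ (s + 1) (hρ0 s).le ?_))
    rw [hpow, lt_div_iff₀ (hM p)]
    have h3 : R' ^ (s + 1) * M p * R' ^ p < M (p + 1 + s) * R' ^ p := by
      calc R' ^ (s + 1) * M p * R' ^ p = R' ^ (p + 1 + s) * M p := by ring
        _ < M 0 * R' ^ p * (p + 1 + s).factorial := hs
        _ = (M 0 * (p + 1 + s).factorial) * R' ^ p := by ring
        _ ≤ _ := by gcongr
    exact lt_of_mul_lt_mul_right h3 (by positivity)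
  obtain ⟨s, hs⟩ := (Nat.cofinite_eq_atTop ▸ htend).exists_forall_le
  have hle : r ≤ ρ s := by
    refine le_of_pow_le_pow_left₀ (Nat.succ_ne_zero s) (hρ0 s).le ?_
    rw [Nat.succ_eq_add_one, hpow, le_div_iff₀ (hM p)]
    have := h (p + 1 + s)
    have h3 : r ^ (s + 1) * M p * r ^ p ≤ M (p + 1 + s) * r ^ p := by
      calc _ = M p * r ^ (p + 1 + s) := by ring
        _ ≤ _ := this
    exact le_of_mul_le_mul_right h3 (by positivity)
  refine ⟨p + 1 + s, ρ s, by omega, hle, fun j => ?_, ?_⟩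
  · rcases lt_or_ge p j with hj | hj
    · obtain ⟨t, rfl⟩ := Nat.exists_eq_add_of_lt hj
      have h1 : ρ s ^ (t + 1) ≤ M (p + 1 + t) / M p := by
        rw [← hpow]; exact pow_le_pow_left₀ (hρ0 s).le (hs t) _
      rw [le_div_iff₀ (hM p)] at h1
      have e : p + t + 1 = p + 1 + t := by ring
      rw [e]
      calc M p * ρ s ^ (p + 1 + t) = (ρ s ^ (t + 1) * M p) * ρ s ^ p := by ring
        _ ≤ _ := by have := hρ0 s; gcongr
    · obtain ⟨t, rfl⟩ := Nat.exists_eq_add_of_le hj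
      have h1 := h j
      have h2 : M (j + t) * r ^ j ≤ (M j * r ^ t) * r ^ j := by
        calc _ ≤ _ := h1
          _ = _ := by ring
      have h3 : M (j + t) ≤ M j * r ^ t := le_of_mul_le_mul_right h2 (by positivity)
      have h4 : M (j + t) ≤ M j * ρ s ^ t := h3.trans (by have := (hM j).le; gcongr)
      calc M (j + t) * ρ s ^ j ≤ (M j * ρ s ^ t) * ρ s ^ j := by have := hρ0 s; gcongr
        _ = _ := by ring
  · calc M p * ρ s ^ (p + 1 + s) = M p * ρ s ^ (s + 1) * ρ s ^ p := by ring
      _ = _ := by rw [hpow, mul_div_cancel₀ _ (hM p).ne']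

/-- If `M n / n!` is non-decreasing, the points of contact of `M` with its minorant contain an
increasing sequence `p i` such that the minorant is geometric, with ratio
`r i`, between `p i` and `p (i + 1)`; the ratios are non-decreasing. -/
lemma exists_contact_sequence (hM : ∀ n, 0 < M n)
    (hmono : Monotone fun n : ℕ => M n / (n.factorial : ℝ)) :
    ∃ (p : ℕ → ℕ) (r : ℕ → ℝ), (∀ i, p i < p (i + 1)) ∧ (∀ i, 0 < r i) ∧
      (∀ i, M (p i) = logConvexMinorant M (p i)) ∧
      (∀ i n, p i ≤ n → n < p (i + 1) →
        logConvexMinorant M (n + 1) = r i * logConvexMinorant M n) ∧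
      (∀ i n, n < p (i + 1) →
        logConvexMinorant M (n + 1) ≤ r i * logConvexMinorant M n) ∧
      (∀ n, 0 < logConvexMinorant M n) := by
  have hpos : ∀ n, 0 < logConvexMinorant M n := fun n => by
    have := geometric_le_logConvexMinorant (M := M) (hM 0) one_pos (fun j => ?_) n
    · exact lt_of_lt_of_le (by simpa using hM 0) this
    · refine le_trans ?_ (mul_factorial_le_of_monotone hmono j)
      have : (1 : ℝ) ≤ j.factorial := by exact_mod_cast Nat.factorial_pos j
      simpa using le_mul_of_one_le_right (hM 0).le this
  let S := {σ : ℕ × ℝ // 0 < σ.2 ∧ ∀ j, M σ.1 * σ.2 ^ j ≤ M j * σ.2 ^ σ.1}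
  have hnext : ∀ σ : S, ∃ τ : S, σ.1.1 < τ.1.1 ∧ σ.1.2 ≤ τ.1.2 ∧
      (∀ j, M σ.1.1 * τ.1.2 ^ j ≤ M j * τ.1.2 ^ σ.1.1) ∧
      M σ.1.1 * τ.1.2 ^ τ.1.1 = M τ.1.1 * τ.1.2 ^ σ.1.1 := by
    rintro ⟨⟨p, r⟩, hr, h⟩
    obtain ⟨l, r', h1, h2, h3, h4⟩ := exists_next_contact hM hmono hr h
    have hr' : 0 < r' := hr.trans_le h2
    refine ⟨⟨⟨l, r'⟩, hr', fun j => ?_⟩, h1, h2, h3, h4⟩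
    have h5 : (M l * r' ^ j) * r' ^ p ≤ (M j * r' ^ l) * r' ^ p := by
      calc (M l * r' ^ j) * r' ^ p = (M l * r' ^ p) * r' ^ j := by ring
        _ = (M p * r' ^ j) * r' ^ l := by rw [← h4]; ring
        _ ≤ (M j * r' ^ p) * r' ^ l := mul_le_mul_of_nonneg_right (h3 j) (by positivity)
        _ = _ := by ring
    exact le_of_mul_le_mul_right h5 (by positivity)
  choose next hn1 hn2 hn3 hn4 using hnext
  have hinit : 0 < (1 : ℝ) ∧ ∀ j, M 0 * (1 : ℝ) ^ j ≤ M j * 1 ^ 0 := by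
    refine ⟨one_pos, fun j => ?_⟩
    refine le_trans ?_ ((mul_factorial_le_of_monotone hmono j).trans (by simp))
    have : (1 : ℝ) ≤ j.factorial := by exact_mod_cast Nat.factorial_pos j
    simpa using le_mul_of_one_le_right (hM 0).le this
  let σ : ℕ → S := fun i => Nat.rec ⟨(0, 1), hinit⟩ (fun _ τ => next τ) i
  have hσ : ∀ i, σ (i + 1) = next (σ i) := fun i => rfl
  have hgeo : ∀ i n, (σ i).1.1 ≤ n → n ≤ (σ (i + 1)).1.1 →
      logConvexMinorant M n =
        M (σ i).1.1 / (σ (i + 1)).1.2 ^ (σ i).1.1 * (σ (i + 1)).1.2 ^ n := by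
    intro i n h1 h2
    have hr : 0 < (σ (i + 1)).1.2 := (σ (i + 1)).2.1
    have hrp : 0 < (σ (i + 1)).1.2 ^ (σ i).1.1 := pow_pos hr _
    refine logConvexMinorant_eq_geometric hM (div_pos (hM _) hrp) hr (fun j => ?_) ?_ ?_ h1 h2
    · rw [div_mul_eq_mul_div, div_le_iff₀ hrp]
      exact hn3 (σ i) j
    · rw [div_mul_cancel₀ _ hrp.ne']
    · rw [div_mul_eq_mul_div, eq_div_iff hrp.ne']
      exact (hn4 (σ i)).symm
  have heq : ∀ i n, (σ i).1.1 ≤ n → n < (σ (i + 1)).1.1 →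
      logConvexMinorant M (n + 1) = (σ (i + 1)).1.2 * logConvexMinorant M n := by
    intro i n h1 h2
    rw [hgeo i n h1 h2.le, hgeo i (n + 1) (by omega) h2]
    ring
  refine ⟨fun i => (σ i).1.1, fun i => (σ (i + 1)).1.2, fun i => hn1 (σ i),
    fun i => (σ (i + 1)).2.1, fun i => ?_, heq, fun i => ?_, hpos⟩
  · rw [hgeo i _ le_rfl (hn1 (σ i)).le, div_mul_cancel₀ _ (pow_pos (σ (i + 1)).2.1 _).ne']
  · induction i with
    | zero => exact fun n hn => (heq 0 n (Nat.zero_le n) hn).le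
    | succ i ih =>
      intro n hn
      rcases lt_or_ge n (σ (i + 1)).1.1 with h | h
      · refine (ih n h).trans ?_
        exact mul_le_mul_of_nonneg_right (hn2 (σ (i + 1))) (hpos n).le
      · exact (heq (i + 1) n h hn).le

end Minorant

/-! ### Bang's argument -/

section Bang

variable {E : Type*} [NormedAddCommGroup E] [NormedSpace ℝ E]

/-- One step of Bang's argument. Suppose that the derivatives `f j`, `j < l`, are at `x` smaller by
the factors `e ^ (j - l)` than their expected size `A B^j W_j`, and that the derivative of order `l`
has the expected size throughout. Moving to the right by `h`, one loses at most the factor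
`exp (e B r h)`, where `r` bounds the ratios of `W` below `l`. -/
lemma bang_step {f : ℕ → ℝ → E} {T A B r : ℝ} {W : ℕ → ℝ} (hA : 0 < A) (hB : 0 < B)
    (hf : ∀ n, ∀ x ∈ Set.Icc 0 T, HasDerivWithinAt (f n) (f (n + 1) x) (Set.Icc 0 T) x)
    {l : ℕ} (hW : ∀ n < l, W (n + 1) ≤ r * W n) (hWpos : ∀ n, 0 < W n)
    (hl : ∀ x ∈ Set.Icc 0 T, ‖f l x‖ ≤ A * B ^ l * W l) {x : ℝ} (hx0 : 0 ≤ x)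
    (hr : 0 < r)
    (hx : ∀ j ≤ l, ‖f j x‖ ≤ A * B ^ j * W j * Real.exp ((j : ℝ) - l)) :
    ∀ j ≤ l, ∀ y ∈ Set.Icc x T,
      ‖f j y‖ ≤ A * B ^ j * W j * Real.exp ((j : ℝ) - l + Real.exp 1 * B * r * (y - x)) := by
  intro j hj
  have hsub : Set.Icc x T ⊆ Set.Icc 0 T := Set.Icc_subset_Icc_left hx0
  induction hj using Nat.decreasingInduction with
  | self =>
    intro y hy
    refine (hl y (hsub hy)).trans (le_mul_of_one_le_right ?_ ?_)
    · have := hWpos l; positivity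
    · refine Real.one_le_exp ?_
      have : 0 ≤ y - x := sub_nonneg.2 hy.1
      have := Real.exp_pos 1
      rw [sub_self, zero_add]
      positivity
  | of_succ j hj ih =>
    set D := A * B ^ j * W j with hD
    have hDpos : 0 < D := by have := hWpos j; positivity
    refine image_norm_le_of_norm_deriv_right_le_deriv_boundary (f' := f (j + 1))
      (B' := fun y => D * (Real.exp ((j : ℝ) - l + Real.exp 1 * B * r * (y - x))
        * (Real.exp 1 * B * r)))
      (fun y hy => ((hf j y (hsub hy)).continuousWithinAt).mono hsub)
      (fun y hy => ?_) ?_ (fun y => ?_) (fun y hy => ?_)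
    · have hy' : y ∈ Set.Icc 0 T := hsub ⟨hy.1, hy.2.le⟩
      refine (hf j y hy').mono_of_mem_nhdsWithin ?_
      exact Filter.mem_of_superset (Icc_mem_nhdsGE hy.2) (Set.Icc_subset_Icc_left hy'.1)
    · simpa using hx j hj.le
    · refine (HasDerivAt.exp ?_).const_mul D
      simpa using (((hasDerivAt_id y).sub_const x).const_mul (Real.exp 1 * B * r)).const_add
        ((j : ℝ) - l)
    · refine (ih y ⟨hy.1, hy.2.le⟩).trans ?_
      have e : ((j + 1 : ℕ) : ℝ) - l + Real.exp 1 * B * r * (y - x)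
          = 1 + ((j : ℝ) - l + Real.exp 1 * B * r * (y - x)) := by push_cast; ring
      rw [e, Real.exp_add 1, hD]
      have := hW j hj
      calc A * B ^ (j + 1) * W (j + 1) * (Real.exp 1 *
            Real.exp ((j : ℝ) - l + Real.exp 1 * B * r * (y - x)))
          ≤ A * B ^ (j + 1) * (r * W j) * (Real.exp 1 *
            Real.exp ((j : ℝ) - l + Real.exp 1 * B * r * (y - x))) := by gcongr
        _ = _ := by ring

/-- The Denjoy-Carleman theorem, sufficiency, for sequences `f` of successive derivatives on an
interval, starting at a point where all of them vanish. -/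
theorem eq_zero_of_denjoyCarleman {M : ℕ → ℝ} (hM : ∀ n, 0 < M n)
    (hmono : Monotone fun n : ℕ => M n / (n.factorial : ℝ)) (hDC : DenjoyCarlemanCondition M)
    {f : ℕ → ℝ → E} {T A B : ℝ} (hA : 0 < A) (hB : 0 < B)
    (hf : ∀ n, ∀ x ∈ Set.Icc 0 T, HasDerivWithinAt (f n) (f (n + 1) x) (Set.Icc 0 T) x)
    (hbd : ∀ n, ∀ x ∈ Set.Icc 0 T, ‖f n x‖ ≤ A * B ^ n * M n) (h0 : ∀ n, f n 0 = 0) :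
    ∀ x ∈ Set.Icc 0 T, f 0 x = 0 := by
  obtain ⟨p, r, hp, hr, hcontact, heq, hle, hpos⟩ := exists_contact_sequence hM hmono
  set W := logConvexMinorant M with hW
  have he := Real.exp_pos 1
  set c := (Real.exp 1 * B)⁻¹ with hc
  have hcpos : 0 < c := by positivity
  have hpi : ∀ i, ∀ d, p i ≤ p (i + d) := fun i d =>
    (strictMono_nat_of_lt_succ hp).monotone (by omega)
  -- If the derivatives are small of order `p (i + d)` at `x`, they are small of order `p i` up to
  -- the distance `c * ∑ W n / W (n + 1)`, `p i ≤ n < p (i + d)`.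
  have key : ∀ d i x, 0 ≤ x →
      (∀ j ≤ p (i + d), ‖f j x‖ ≤ A * B ^ j * W j * Real.exp ((j : ℝ) - p (i + d))) →
      ∀ y ∈ Set.Icc x T, y ≤ x + c * ∑ n ∈ Finset.Ico (p i) (p (i + d)), W n / W (n + 1) →
      ∀ j ≤ p i, ‖f j y‖ ≤ A * B ^ j * W j * Real.exp ((j : ℝ) - p i) := by
    intro d
    induction d with
    | zero =>
      intro i x hx0 hx y hy hyx
      simp only [add_zero, Finset.Ico_self, Finset.sum_empty, mul_zero] at hyx hx
      have : y = x := le_antisymm hyx hy.1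
      exact this ▸ hx
    | succ d ih =>
      intro i x hx0 hx y hy hyx
      have hlt := hp (i + d)
      set l := p (i + d + 1) with hl
      set q := p (i + d) with hq
      have hR := hr (i + d)
      set R := r (i + d)
      have hsum : ∑ n ∈ Finset.Ico q l, W n / W (n + 1) = ((l : ℝ) - q) / R := by
        rw [Finset.sum_congr rfl (g := fun _ => R⁻¹), Finset.sum_const, Nat.card_Ico,
          nsmul_eq_mul, Nat.cast_sub hlt.le, div_eq_mul_inv]
        intro n hn
        rw [Finset.mem_Ico] at hn
        rw [heq (i + d) n hn.1 hn.2, div_eq_iff (mul_pos hR (hpos n)).ne']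
        field_simp
      have hsplit := Finset.sum_Ico_consecutive (fun n => W n / W (n + 1)) (hpi i d) hlt.le
      have hyx' : y ≤ x + c * (∑ n ∈ Finset.Ico (p i) q, W n / W (n + 1) + ((l : ℝ) - q) / R) := by
        rw [← hsum, hsplit]; exact hyx
      set z := min y (x + c * (((l : ℝ) - q) / R)) with hz
      have hlq : (0 : ℝ) < (l : ℝ) - q := sub_pos.2 (by exact_mod_cast hlt)
      have hxz : x ≤ z := le_min hy.1 (le_add_of_nonneg_right (by positivity))
      have hzy : z ≤ y := min_le_left _ _
      have hzT : z ≤ T := hzy.trans hy.2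
      have hstep := bang_step hA hB hf (fun n hn => hle (i + d) n hn) hpos
        (fun t ht => by have := hbd l t ht; rwa [hl, hcontact, ← hl] at this) hx0 hR hx
      refine ih i z (hx0.trans hxz) (fun j hj => ?_) y ⟨hzy, hy.2⟩ ?_
      · refine (hstep j (hj.trans hlt.le) z ⟨hxz, hzT⟩).trans ?_
        have hW' := hpos j
        refine mul_le_mul_of_nonneg_left (Real.exp_le_exp.2 ?_) (by positivity)
        have h1 : z - x ≤ c * (((l : ℝ) - q) / R) := by
          have := min_le_right y (x + c * (((l : ℝ) - q) / R)); linarith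
        have h2 : Real.exp 1 * B * R * (z - x) ≤ (l : ℝ) - q := by
          calc Real.exp 1 * B * R * (z - x) ≤ Real.exp 1 * B * R * (c * (((l : ℝ) - q) / R)) := by
                gcongr
            _ = (l : ℝ) - q := by rw [hc]; field_simp
        linarith
      · rcases min_choice y (x + c * (((l : ℝ) - q) / R)) with h | h
        · rw [hz, h]
          refine le_add_of_nonneg_right (mul_nonneg hcpos.le (Finset.sum_nonneg fun n _ => ?_))
          exact (div_pos (hpos _) (hpos _)).le
        · rw [hz, h]; linarith
  intro x hx
  have hsmall : ∀ i, ‖f 0 x‖ ≤ A * W 0 * Real.exp (-(p i : ℝ)) := by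
    intro i
    obtain ⟨N, hN1, hN2⟩ := ((hDC.eventually_ge_atTop
      (∑ n ∈ Finset.range (p i), W n / W (n + 1) + x / c)).and
        (Filter.eventually_ge_atTop i)).exists
    obtain ⟨d, rfl⟩ := Nat.exists_eq_add_of_le hN2
    have hNp : i + d ≤ p (i + d) := (strictMono_nat_of_lt_succ hp).le_apply
    have hS : x / c ≤ ∑ n ∈ Finset.Ico (p i) (p (i + d)), W n / W (n + 1) := by
      rw [Finset.sum_Ico_eq_sub _ (hpi i d), le_sub_iff_add_le, add_comm]
      refine hN1.trans (Finset.sum_le_sum_of_subset_of_nonneg (Finset.range_mono hNp) ?_)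
      exact fun n _ _ => (div_pos (hpos _) (hpos _)).le
    rw [div_le_iff₀ hcpos] at hS
    have := key d i 0 le_rfl (fun j _ => ?_) x hx (by linarith) 0 (Nat.zero_le _)
    · simpa using this
    · rw [h0, norm_zero]
      have := hpos j
      positivity
  have htend : Filter.Tendsto (fun i => A * W 0 * Real.exp (-(p i : ℝ))) Filter.atTop
      (nhds (A * W 0 * 0)) := by
    refine Filter.Tendsto.const_mul _ (Real.tendsto_exp_neg_atTop_nhds_zero.comp ?_)
    exact tendsto_natCast_atTop_atTop.comp (strictMono_nat_of_lt_succ hp).tendsto_atTop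
  have := ge_of_tendsto' htend hsmall
  rw [mul_zero] at this
  exact norm_le_zero_iff.1 this

end Bang

/-! ### Removing the weight by the substitution `x = t ^ k` -/

section Weight

variable {E : Type*} [NormedAddCommGroup E] [NormedSpace ℝ E]

lemma norm_le_of_norm_deriv_le_rpow {f f' : ℝ → E} {δ β C : ℝ} (hδ : δ ≤ 1) (hβ : β ≠ 0)
    (hC : 0 ≤ C) (hf : ∀ x ∈ Set.Icc 0 δ, HasDerivWithinAt f (f' x) (Set.Icc 0 δ) x)
    (hf' : ∀ x ∈ Set.Ioc 0 δ, ‖f' x‖ ≤ C * x ^ (-(1 + β))) {x : ℝ} (hx : x ∈ Set.Ioc 0 δ) :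
    ‖f x‖ ≤ ‖f δ‖ + C / |β| * x ^ (-max 0 β) := by
  have hsub : Set.Icc x δ ⊆ Set.Icc 0 δ := Set.Icc_subset_Icc_left hx.1.le
  have key := image_norm_le_of_norm_deriv_right_le_deriv_boundary' (f := fun t => f t - f x)
    (f' := f') (a := x) (b := δ) (B := fun t => C / β * (x ^ (-β) - t ^ (-β)))
    (B' := fun t => C * t ^ (-(1 + β)))
    (fun y hy => (((hf y (hsub hy)).continuousWithinAt).mono hsub).sub continuousWithinAt_const)
    (fun y hy => ?_) (by simp) (fun y hy => ?_) (fun y hy => ?_)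
    (fun y hy => hf' y ⟨hx.1.trans_le hy.1, hy.2.le⟩) ⟨hx.2, le_rfl⟩
  · have h1 : ‖f x‖ ≤ ‖f δ‖ + ‖f δ - f x‖ := by
      have := norm_sub_le (f δ) (f δ - f x); simpa using this
    refine h1.trans (add_le_add_right (key.trans ?_) _)
    have hδ0 : 0 < δ := hx.1.trans_le hx.2
    rcases lt_or_gt_of_ne hβ with h | h
    · rw [max_eq_left h.le, abs_of_neg h, neg_zero, Real.rpow_zero, mul_one]
      have e : C / β * (x ^ (-β) - δ ^ (-β)) = C / -β * (δ ^ (-β) - x ^ (-β)) := by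
        rw [div_neg]; ring
      rw [e]
      have h2 : δ ^ (-β) ≤ 1 := Real.rpow_le_one hδ0.le hδ (by linarith)
      have h3 : 0 ≤ x ^ (-β) := Real.rpow_nonneg hx.1.le _
      exact mul_le_of_le_one_right (div_nonneg hC (by linarith)) (by linarith)
    · rw [max_eq_right h.le, abs_of_pos h]
      have h3 : 0 ≤ δ ^ (-β) := Real.rpow_nonneg hδ0.le _
      exact mul_le_mul_of_nonneg_left (by linarith) (by positivity)
  · refine HasDerivWithinAt.sub_const (f x) ?_
    refine (hf y (hsub ⟨hy.1, hy.2.le⟩)).mono_of_mem_nhdsWithin ?_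
    exact Filter.mem_of_superset (Icc_mem_nhdsGE hy.2)
      (Set.Icc_subset_Icc_left (hx.1.le.trans hy.1))
  · have hy0 : y ≠ 0 := (hx.1.trans_le hy.1).ne'
    exact (continuousAt_const.mul (continuousAt_const.sub
      (Real.continuousAt_rpow_const y _ (Or.inl hy0)))).continuousWithinAt
  · have hy0 : y ≠ 0 := (hx.1.trans_le hy.1).ne'
    have := ((Real.hasDerivAt_rpow_const (x := y) (p := -β) (Or.inl hy0)).const_sub
      (x ^ (-β))).const_mul (C / β)
    refine (this.congr_deriv ?_).hasDerivWithinAt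
    rw [show -β - 1 = -(1 + β) by ring]
    field_simp

/-- A bound of order `x ^ -(m - m / k - 1 / (2 k))` on the derivative of order `m` is integrated
`m - j` times. The exponent `(2 (k j - m) - 1) / (2 k)` obtained is never zero, so no logarithm
occurs, and the product of the denominators compensates a factorial. -/
lemma norm_le_of_norm_iterated_deriv_le {M : ℕ → ℝ} (hM : ∀ n, 0 < M n)
    (hmono : Monotone fun n : ℕ => M n / (n.factorial : ℝ)) {g : ℕ → ℝ → E} {δ A B : ℝ}
    (hδ : δ ≤ 1) (hA : 0 < A) (hB : 1 ≤ B)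
    (hg : ∀ n, ∀ x ∈ Set.Icc 0 δ, HasDerivWithinAt (g n) (g (n + 1) x) (Set.Icc 0 δ) x)
    (hend : ∀ n, ‖g n δ‖ ≤ A * B ^ n * M n) {k m : ℕ} (hk : 2 ≤ k) (hm : 1 ≤ m)
    (htop : ∀ x ∈ Set.Ioc 0 δ,
      ‖g m x‖ ≤ A * B ^ m * M m * x ^ (-((2 * ((k : ℝ) * m - m) - 1) / (2 * k))))
    {j : ℕ} (hjm : j ≤ m) (hj : m ≤ k * j) {x : ℝ} (hx : x ∈ Set.Ioc 0 δ) :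
    ‖g j x‖ ≤ A * (16 * k * B) ^ m * M m / (m - j).factorial *
      x ^ (-max 0 ((2 * ((k : ℝ) * j - m) - 1) / (2 * k))) := by
  have hk0 : (2 : ℝ) ≤ k := by exact_mod_cast hk
  have hm0 : (1 : ℝ) ≤ m := by exact_mod_cast hm
  -- `s` is the least order that is reached, the integer part from above of `m / k`.
  have hex : ∃ s, m ≤ k * s := ⟨j, hj⟩
  obtain ⟨s, hs, hsmin⟩ : ∃ s, m ≤ k * s ∧ ∀ i, m ≤ k * i → s ≤ i :=
    ⟨Nat.find hex, Nat.find_spec hex, fun i hi => Nat.find_min' hex hi⟩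
  have hMm := hM m
  have hMj : ∀ i ≤ m, B ^ i * M i ≤ B ^ m * M m / (m - i).factorial := by
    intro i hi
    have h1 := hmono hi
    simp only at h1
    rw [div_le_div_iff₀ (by positivity) (by positivity)] at h1
    have h2 : ((i.factorial * (m - i).factorial : ℕ) : ℝ) ≤ m.factorial := by
      have := Nat.le_of_dvd (Nat.factorial_pos _) (Nat.factorial_mul_factorial_dvd_factorial hi)
      exact_mod_cast this
    push_cast at h2
    have hMi := hM i
    have h3 : M i * (m - i).factorial ≤ M m := by
      have h4 : (M i * (m - i).factorial) * i.factorial ≤ M m * i.factorial := by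
        calc _ = M i * (i.factorial * (m - i).factorial) := by ring
          _ ≤ M i * m.factorial := by gcongr
          _ ≤ _ := h1
      exact le_of_mul_le_mul_right h4 (by positivity)
    rw [le_div_iff₀ (by positivity)]
    calc B ^ i * M i * (m - i).factorial = B ^ i * (M i * (m - i).factorial) := by ring
      _ ≤ B ^ m * M m := by gcongr
  have main : ∀ i, i ≤ m → m ≤ k * i → ∀ x ∈ Set.Ioc 0 δ,
      ‖g i x‖ ≤ A * B ^ m * M m * ((8 * k) ^ (m - i) *
        (2 ^ (m - s) * (i - s).factorial / (m - s).factorial)) *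
      x ^ (-max 0 ((2 * ((k : ℝ) * i - m) - 1) / (2 * k))) := by
    intro i hi
    induction hi using Nat.decreasingInduction with
    | self =>
      intro _ x hx
      have hpos : 0 ≤ (2 * ((k : ℝ) * m - m) - 1) / (2 * k) := by
        refine div_nonneg ?_ (by positivity)
        nlinarith
      rw [max_eq_right hpos, Nat.sub_self, pow_zero, one_mul]
      refine (htop x hx).trans ?_
      refine mul_le_mul_of_nonneg_right ?_ (Real.rpow_nonneg hx.1.le _)
      refine le_mul_of_one_le_right (by positivity) ?_
      rw [mul_div_assoc, div_self (by positivity), mul_one]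
      exact one_le_pow₀ one_le_two
    | of_succ i hi ih =>
      intro hki x hx
      set β : ℝ := (2 * ((k : ℝ) * i - m) - 1) / (2 * k) with hβ
      have hsi : s ≤ i := hsmin i hki
      have hβ1 : (2 * ((k : ℝ) * (i + 1 : ℕ) - m) - 1) / (2 * k) = 1 + β := by
        rw [hβ]; push_cast; field_simp; ring
      have hβabs : ((i - s : ℕ) + 1 : ℝ) / (4 * k) ≤ |β| := by
        rcases hki.eq_or_lt with h | h
        · have hsi' : s = i := by
            refine le_antisymm hsi ?_
            have : k * i ≤ k * s := h ▸ hs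
            exact Nat.le_of_mul_le_mul_left this (by omega)
          have h' : (m : ℝ) = k * i := by exact_mod_cast h
          rw [hβ, hsi', h', Nat.sub_self, sub_self, mul_zero, zero_sub, abs_div, abs_neg, abs_one,
            abs_of_pos (by positivity : (0 : ℝ) < 2 * k), div_le_div_iff₀ (by positivity)
            (by positivity)]
          push_cast; linarith
        · refine le_trans ?_ (le_abs_self β)
          have h' : (m : ℝ) + 1 ≤ k * i := by exact_mod_cast h
          have h2 : 2 * ((i - s : ℕ) : ℝ) ≤ k * i - m := by
            have e : k * s + k * (i - s) = k * i := by rw [← mul_add]; congr 1; omega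
            have : m + 2 * (i - s) ≤ k * i := by nlinarith
            have : (m : ℝ) + 2 * ((i - s : ℕ) : ℝ) ≤ k * i := by exact_mod_cast this
            linarith
          have h3 : (0 : ℝ) ≤ ((i - s : ℕ) : ℝ) := Nat.cast_nonneg _
          rw [hβ, div_le_div_iff₀ (by positivity) (by positivity)]
          nlinarith
      have hβpos : 0 < |β| := lt_of_lt_of_le (by positivity) hβabs
      have hβ0 : β ≠ 0 := abs_pos.1 hβpos
      have hβ1pos : 0 ≤ 1 + β := by
        rw [← hβ1]
        refine div_nonneg ?_ (by positivity)
        have : (m : ℝ) ≤ k * i := by exact_mod_cast hki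
        push_cast; linarith
      set C : ℝ := A * B ^ m * M m * ((8 * k) ^ (m - (i + 1)) *
        (2 ^ (m - s) * (i + 1 - s).factorial / (m - s).factorial)) with hC
      have hC0 : 0 ≤ C := by positivity
      have ih' : ∀ x ∈ Set.Ioc 0 δ, ‖g (i + 1) x‖ ≤ C * x ^ (-(1 + β)) := by
        intro y hy
        have := ih (hki.trans (Nat.mul_le_mul_left k (Nat.le_succ i))) y hy
        rwa [hβ1, max_eq_right hβ1pos] at this
      refine (norm_le_of_norm_deriv_le_rpow hδ hβ0 hC0 (hg i) ih' hx).trans ?_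
      have hxp : 1 ≤ x ^ (-max 0 β) :=
        Real.one_le_rpow_of_pos_of_le_one_of_nonpos hx.1 (hx.2.trans hδ)
          (neg_nonpos.2 (le_max_left _ _))
      set Q : ℝ := 2 ^ (m - s) * (i - s).factorial / (m - s).factorial with hQ
      have hi' : m - i = (m - (i + 1)) + 1 := by omega
      have hQ1 : 1 / ((m - i).factorial : ℝ) ≤ Q := by
        have h1 := Nat.choose_mul_factorial_mul_factorial (show m - i ≤ m - s by omega)
        rw [show m - s - (m - i) = i - s by omega] at h1
        have h2 : (m - s).choose (m - i) ≤ 2 ^ (m - s) := Nat.choose_le_two_pow _ _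
        rw [hQ, div_le_div_iff₀ (by positivity) (by positivity), one_mul]
        have : (m - s).factorial ≤ 2 ^ (m - s) * (i - s).factorial * (m - i).factorial := by
          calc (m - s).factorial = (m - s).choose (m - i) * ((i - s).factorial
                * (m - i).factorial) := by rw [← h1]; ring
            _ ≤ 2 ^ (m - s) * ((i - s).factorial * (m - i).factorial) :=
                Nat.mul_le_mul_right _ h2
            _ = _ := by ring
        exact_mod_cast this
      have hQ0 : 0 ≤ Q := by positivity
      have hend' : ‖g i δ‖ ≤ A * B ^ m * M m * Q := by
        calc ‖g i δ‖ ≤ A * (B ^ i * M i) := by rw [← mul_assoc]; exact hend i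
          _ ≤ A * (B ^ m * M m / (m - i).factorial) := by gcongr; exact hMj i hi.le
          _ = A * B ^ m * M m * (1 / (m - i).factorial) := by ring
          _ ≤ _ := by gcongr
      have hCQ : C / |β| ≤ A * B ^ m * M m * ((8 * k) ^ (m - (i + 1)) * (4 * k) * Q) := by
        have e : i + 1 - s = (i - s) + 1 := by omega
        have h1 : C = A * B ^ m * M m * ((8 * k) ^ (m - (i + 1)) * (4 * k) * Q) *
            (((i - s : ℕ) + 1 : ℝ) / (4 * k)) := by
          rw [hC, e, Nat.factorial_succ, hQ]; push_cast; field_simp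
        rw [div_le_iff₀ hβpos, h1]
        gcongr
      have hone : (1 : ℝ) ≤ (8 * k) ^ (m - (i + 1)) := one_le_pow₀ (by linarith)
      have hsum : ‖g i δ‖ + C / |β| ≤ A * B ^ m * M m * ((8 * k) ^ (m - i) * Q) := by
        have h1 : Q ≤ (8 * k) ^ (m - (i + 1)) * (4 * k) * Q := by
          refine le_mul_of_one_le_left hQ0 ?_
          nlinarith
        calc ‖g i δ‖ + C / |β| ≤ A * B ^ m * M m * Q +
              A * B ^ m * M m * ((8 * k) ^ (m - (i + 1)) * (4 * k) * Q) := add_le_add hend' hCQ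
          _ ≤ A * B ^ m * M m * ((8 * k) ^ (m - (i + 1)) * (4 * k) * Q) +
              A * B ^ m * M m * ((8 * k) ^ (m - (i + 1)) * (4 * k) * Q) := by gcongr
          _ = _ := by rw [hi', pow_succ]; ring
      calc ‖g i δ‖ + C / |β| * x ^ (-max 0 β)
          ≤ ‖g i δ‖ * x ^ (-max 0 β) + C / |β| * x ^ (-max 0 β) := by
            gcongr; exact le_mul_of_one_le_right (norm_nonneg _) hxp
        _ = (‖g i δ‖ + C / |β|) * x ^ (-max 0 β) := by ring
        _ ≤ _ := mul_le_mul_of_nonneg_right hsum (by positivity)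
  refine (main j hjm hj x hx).trans ?_
  refine mul_le_mul_of_nonneg_right ?_ (Real.rpow_nonneg hx.1.le _)
  have hsj : s ≤ j := hsmin j hj
  have hfac : ((j - s).factorial : ℝ) / (m - s).factorial ≤ 1 / (m - j).factorial := by
    have h1 := Nat.le_of_dvd (Nat.factorial_pos _)
      (Nat.factorial_mul_factorial_dvd_factorial_add (j - s) (m - j))
    have e : j - s + (m - j) = m - s := by omega
    rw [e] at h1
    rw [div_le_div_iff₀ (by positivity) (by positivity), one_mul]
    exact_mod_cast h1
  have h8 : (1 : ℝ) ≤ 8 * k := by linarith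
  calc A * B ^ m * M m * ((8 * k) ^ (m - j) * (2 ^ (m - s) * (j - s).factorial
        / (m - s).factorial))
      = A * B ^ m * M m * ((8 * k) ^ (m - j) * 2 ^ (m - s) * ((j - s).factorial
        / (m - s).factorial)) := by ring
    _ ≤ A * B ^ m * M m * ((8 * k) ^ m * 2 ^ m * (1 / (m - j).factorial)) := by
        gcongr
        · exact Nat.sub_le _ _
        · exact one_le_two
        · exact Nat.sub_le _ _
    _ = _ := by
        rw [mul_pow, mul_pow, mul_pow, show (16 : ℝ) = 8 * 2 by norm_num, mul_pow]; ring

/-- The coefficients of the derivatives of `t ↦ g (t ^ k)`: the derivative of order `m` is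
`∑ j, powCompCoeff k m j * t ^ (k * j - m) * g⁽ʲ⁾ (t ^ k)`. They vanish when `k * j < m`, so that
the truncated exponent does no harm. -/
def powCompCoeff (k : ℕ) : ℕ → ℕ → ℕ
  | 0, 0 => 1
  | 0, _ + 1 => 0
  | _ + 1, 0 => 0
  | m + 1, j + 1 => (k * (j + 1) - m) * powCompCoeff k m (j + 1) + k * powCompCoeff k m j

lemma powCompCoeff_eq_zero_of_lt (k : ℕ) : ∀ m j, m < j → powCompCoeff k m j = 0
  | 0, _ + 1, _ => rfl
  | m + 1, j + 1, h => by
    rw [powCompCoeff, powCompCoeff_eq_zero_of_lt k m (j + 1) (by omega),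
      powCompCoeff_eq_zero_of_lt k m j (by omega), mul_zero, mul_zero,
      add_zero]

lemma powCompCoeff_eq_zero_of_mul_lt {k : ℕ} (hk : 1 ≤ k) :
    ∀ m j, k * j < m → powCompCoeff k m j = 0
  | _ + 1, 0, _ => rfl
  | m + 1, j + 1, h => by
    have h1 : k * (j + 1) - m = 0 := by omega
    have h2 : k * j < m := by rw [mul_add] at h; omega
    rw [powCompCoeff, h1, powCompCoeff_eq_zero_of_mul_lt hk m j h2]; simp

lemma powCompCoeff_mul_factorial_le (k : ℕ) :
    ∀ m j, powCompCoeff k m j * j.factorial ≤ (2 * k) ^ m * m.factorial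
  | 0, 0 => by simp [powCompCoeff]
  | 0, _ + 1 => by simp [powCompCoeff]
  | _ + 1, 0 => by simp [powCompCoeff]
  | m + 1, j + 1 => by
    rcases le_or_gt j m with hj | hj
    · have h1 := powCompCoeff_mul_factorial_le k m (j + 1)
      have h2 := powCompCoeff_mul_factorial_le k m j
      calc powCompCoeff k (m + 1) (j + 1) * (j + 1).factorial
          = (k * (j + 1) - m) * (powCompCoeff k m (j + 1) * (j + 1).factorial)
            + k * (j + 1) * (powCompCoeff k m j * j.factorial) := by
              rw [powCompCoeff, Nat.factorial_succ]; ring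
        _ ≤ (k * (j + 1)) * ((2 * k) ^ m * m.factorial)
            + k * (j + 1) * ((2 * k) ^ m * m.factorial) :=
              add_le_add (Nat.mul_le_mul (Nat.sub_le _ _) h1) (Nat.mul_le_mul_left _ h2)
        _ = (2 * k) ^ (m + 1) * ((j + 1) * m.factorial) := by ring
        _ ≤ (2 * k) ^ (m + 1) * ((m + 1) * m.factorial) := by gcongr
        _ = _ := by rw [Nat.factorial_succ]
    · rw [powCompCoeff_eq_zero_of_lt k (m + 1) (j + 1) (by omega), zero_mul]
      exact Nat.zero_le _

/-- The formal derivative of order `m` of `t ↦ g (t ^ k)`, where `g j` plays the role of the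
derivative of order `j` of `g`. -/
noncomputable def powComp (k : ℕ) (g : ℕ → ℝ → E) (m : ℕ) (t : ℝ) : E :=
  ∑ j ∈ Finset.range (m + 1), ((powCompCoeff k m j : ℝ) * t ^ (k * j - m)) • g j (t ^ k)

lemma powComp_hasDerivWithinAt {k : ℕ} (hk : 1 ≤ k) {g : ℕ → ℝ → E} {δ : ℝ} (hδ : δ ≤ 1)
    (hg : ∀ n, ∀ x ∈ Set.Icc 0 δ, HasDerivWithinAt (g n) (g (n + 1) x) (Set.Icc 0 δ) x)
    (m : ℕ) {t : ℝ} (ht : t ∈ Set.Icc 0 δ) :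
    HasDerivWithinAt (powComp k g m) (powComp k g (m + 1) t) (Set.Icc 0 δ) t := by
  have hmaps : Set.MapsTo (fun t : ℝ => t ^ k) (Set.Icc 0 δ) (Set.Icc 0 δ) := fun y hy =>
    ⟨pow_nonneg hy.1 k, (pow_le_of_le_one hy.1 (hy.2.trans hδ) (by omega)).trans hy.2⟩
  have hcomp : ∀ j, HasDerivWithinAt (fun t => g j (t ^ k))
      (((k : ℝ) * t ^ (k - 1)) • g (j + 1) (t ^ k)) (Set.Icc 0 δ) t := fun j =>
    (hg j (t ^ k) (hmaps ht)).scomp t (hasDerivAt_pow k t).hasDerivWithinAt hmaps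
  have hterm : ∀ j ∈ Finset.range (m + 1), HasDerivWithinAt
      (fun t => ((powCompCoeff k m j : ℝ) * t ^ (k * j - m)) • g j (t ^ k))
      (((powCompCoeff k m j : ℝ) * t ^ (k * j - m)) • (((k : ℝ) * t ^ (k - 1)) • g (j + 1) (t ^ k))
        + ((powCompCoeff k m j : ℝ) * (((k * j - m : ℕ) : ℝ) * t ^ (k * j - m - 1)))
          • g j (t ^ k)) (Set.Icc 0 δ) t := fun j _ =>
    (((hasDerivAt_pow (k * j - m) t).const_mul (powCompCoeff k m j : ℝ)).hasDerivWithinAt).smul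
      (hcomp j)
  refine (HasDerivWithinAt.fun_sum hterm).congr_deriv ?_
  rw [Finset.sum_add_distrib, powComp, Finset.sum_range_succ' _ (m + 1)]
  have hlast : powCompCoeff k (m + 1) 0 = 0 := rfl
  rw [hlast, Nat.cast_zero, zero_mul, zero_smul, add_zero]
  -- The terms with `k * j - m` factors are shifted by one index.
  have hshift : ∑ j ∈ Finset.range (m + 1),
      ((powCompCoeff k m j : ℝ) * (((k * j - m : ℕ) : ℝ) * t ^ (k * j - m - 1))) • g j (t ^ k)
      = ∑ j ∈ Finset.range (m + 1), ((powCompCoeff k m (j + 1) : ℝ) *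
        (((k * (j + 1) - m : ℕ) : ℝ) * t ^ (k * (j + 1) - m - 1))) • g (j + 1) (t ^ k) := by
    rw [Finset.sum_range_succ', Finset.sum_range_succ (fun j => ((powCompCoeff k m (j + 1) : ℝ) *
        (((k * (j + 1) - m : ℕ) : ℝ) * t ^ (k * (j + 1) - m - 1))) • g (j + 1) (t ^ k)),
      powCompCoeff_eq_zero_of_lt k m (m + 1) (Nat.lt_succ_self m)]
    simp
  rw [hshift, ← Finset.sum_add_distrib]
  refine Finset.sum_congr rfl fun j _ => ?_
  rw [smul_smul, ← add_smul]
  congr 1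
  rw [powCompCoeff, Nat.sub_add_eq]
  push_cast
  rcases lt_or_ge (k * j) m with h | h
  · rw [powCompCoeff_eq_zero_of_mul_lt hk m j h]; simp; ring
  · have e : k * (j + 1) - m - 1 = (k * j - m) + (k - 1) := by rw [mul_add]; omega
    rw [e, pow_add]; ring

/-- The weighted class at a point where all derivatives vanish: under the substitution `x = t ^ k`
with `k` large, the weight `x ^ (-a n)` disappears. -/
theorem eq_zero_of_denjoyCarleman_of_weight {M : ℕ → ℝ} (hM : ∀ n, 0 < M n)
    (hmono : Monotone fun n : ℕ => M n / (n.factorial : ℝ)) (hDC : DenjoyCarlemanCondition M)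
    {a : ℝ} (ha : a < 1) {g : ℕ → ℝ → E} {δ A B : ℝ} (hδ0 : 0 < δ) (hδ : δ ≤ 1)
    (hA : 0 < A) (hB : 0 < B)
    (hg : ∀ n, ∀ x ∈ Set.Icc 0 δ, HasDerivWithinAt (g n) (g (n + 1) x) (Set.Icc 0 δ) x)
    (hbd : ∀ n, ∀ x ∈ Set.Ioc 0 δ, ‖g n x‖ ≤ A * B ^ n * (M n / x ^ (a * (n : ℝ))))
    (h0 : ∀ n, g n 0 = 0) :
    ∃ η ∈ Set.Ioc 0 δ, ∀ x ∈ Set.Icc 0 η, g 0 x = 0 := by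
  obtain ⟨k, hk⟩ := exists_nat_ge (max 2 (3 / (2 * (1 - a))))
  have hk2 : (2 : ℝ) ≤ k := (le_max_left _ _).trans hk
  have hkN : 2 ≤ k := by exact_mod_cast hk2
  have hka : 3 ≤ k * (2 * (1 - a)) := by
    rw [← div_le_iff₀ (by linarith)]; exact (le_max_right _ _).trans hk
  set B₁ := max 1 B / δ with hB₁
  have hB₁1 : 1 ≤ B₁ := by
    rw [hB₁, le_div_iff₀ hδ0]; exact le_trans (by linarith) (le_max_left _ _)
  have hBB₁ : B ≤ B₁ := by
    rw [hB₁, le_div_iff₀ hδ0]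
    exact (mul_le_of_le_one_right hB.le hδ).trans (le_max_right _ _)
  have hend : ∀ n, ‖g n δ‖ ≤ A * B₁ ^ n * M n := by
    intro n
    have hMn := hM n
    have h1 : δ ^ n ≤ δ ^ (a * (n : ℝ)) := by
      rw [← Real.rpow_natCast δ n]
      refine Real.rpow_le_rpow_of_exponent_ge hδ0 hδ ?_
      exact mul_le_of_le_one_left (Nat.cast_nonneg n) ha.le
    calc ‖g n δ‖ ≤ A * B ^ n * (M n / δ ^ (a * (n : ℝ))) := hbd n δ ⟨hδ0, le_rfl⟩
      _ ≤ A * (max 1 B) ^ n * (M n / δ ^ n) := by gcongr; exact le_max_right _ _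
      _ = _ := by rw [hB₁, div_pow]; ring
  have hH : ∀ m, ∀ t ∈ Set.Icc 0 δ,
      ‖powComp k g m t‖ ≤ A * (64 * k ^ 2 * B₁) ^ m * M m := by
    intro m t ht
    have hMm := hM m
    rcases ht.1.eq_or_lt with rfl | ht0
    · have : powComp k g m 0 = 0 := by
        refine Finset.sum_eq_zero fun j _ => ?_
        rw [zero_pow (n := k) (by omega), h0, smul_zero]
      rw [this, norm_zero]; positivity
    have hx : t ^ k ∈ Set.Ioc 0 δ := ⟨pow_pos ht0 k,
      (pow_le_of_le_one ht.1 (ht.2.trans hδ) (by omega)).trans ht.2⟩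
    rcases Nat.eq_zero_or_pos m with rfl | hm
    · have := hbd 0 (t ^ k) hx
      simpa [powComp, powCompCoeff] using this
    have hm1 : (1 : ℝ) ≤ m := by exact_mod_cast hm
    have htop : ∀ x ∈ Set.Ioc 0 δ,
        ‖g m x‖ ≤ A * B₁ ^ m * M m * x ^ (-((2 * ((k : ℝ) * m - m) - 1) / (2 * k))) := by
      intro x hx
      have h1 : x ^ (-(a * (m : ℝ))) ≤ x ^ (-((2 * ((k : ℝ) * m - m) - 1) / (2 * k))) := by
        refine Real.rpow_le_rpow_of_exponent_ge hx.1 (hx.2.trans hδ) (neg_le_neg ?_)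
        rw [le_div_iff₀ (by positivity)]
        nlinarith
      have hxp : 0 ≤ x ^ (-((2 * ((k : ℝ) * m - m) - 1) / (2 * k))) := Real.rpow_nonneg hx.1.le _
      calc ‖g m x‖ ≤ A * B ^ m * (M m / x ^ (a * (m : ℝ))) := hbd m x hx
        _ = A * B ^ m * M m * x ^ (-(a * (m : ℝ))) := by rw [Real.rpow_neg hx.1.le]; ring
        _ ≤ A * B ^ m * M m * x ^ (-((2 * ((k : ℝ) * m - m) - 1) / (2 * k))) := by gcongr
        _ ≤ _ := by gcongr
    have hterm : ∀ j ∈ Finset.range (m + 1),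
        ‖((powCompCoeff k m j : ℝ) * t ^ (k * j - m)) • g j (t ^ k)‖
          ≤ A * (32 * k ^ 2 * B₁) ^ m * M m * (m.choose j : ℝ) := by
      intro j hj
      have hjm : j ≤ m := Nat.lt_succ_iff.1 (Finset.mem_range.1 hj)
      rcases lt_or_ge (k * j) m with h | h
      · rw [powCompCoeff_eq_zero_of_mul_lt (by omega) m j h]
        simp only [Nat.cast_zero, zero_mul, zero_smul, norm_zero]
        positivity
      have h1 := norm_le_of_norm_iterated_deriv_le hM hmono hδ hA hB₁1 hg hend hkN hm htop hjm h hx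
      have hmk : (m : ℝ) ≤ k * j := by exact_mod_cast h
      have h2 : (t ^ k) ^ (-max 0 ((2 * ((k : ℝ) * j - m) - 1) / (2 * k)))
          ≤ (t ^ (k * j - m))⁻¹ := by
        have e : (t ^ (k * j - m))⁻¹ = (t ^ k) ^ (-(((k : ℝ) * j - m) / k)) := by
          rw [← Real.rpow_natCast t k, ← Real.rpow_mul ht.1, ← Real.rpow_natCast t (k * j - m),
            Nat.cast_sub h, ← Real.rpow_neg ht.1]
          congr 1
          push_cast
          field_simp
        rw [e]
        refine Real.rpow_le_rpow_of_exponent_ge hx.1 (hx.2.trans hδ) (neg_le_neg (max_le ?_ ?_))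
        · exact div_nonneg (by linarith) (by positivity)
        · rw [div_le_div_iff₀ (by positivity) (by positivity)]; nlinarith
      have h3 : (powCompCoeff k m j : ℝ) ≤ (2 * k) ^ m * m.factorial / j.factorial := by
        rw [le_div_iff₀ (by positivity)]
        exact_mod_cast powCompCoeff_mul_factorial_le k m j
      have htp : 0 < t ^ (k * j - m) := pow_pos ht0 _
      rw [norm_smul, Real.norm_of_nonneg (by positivity)]
      calc (powCompCoeff k m j : ℝ) * t ^ (k * j - m) * ‖g j (t ^ k)‖
          ≤ ((2 * k) ^ m * m.factorial / j.factorial) * t ^ (k * j - m) *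
            (A * (16 * k * B₁) ^ m * M m / (m - j).factorial * (t ^ (k * j - m))⁻¹) := by
              gcongr
              exact h1.trans (by gcongr)
        _ = A * ((2 * k) ^ m * (16 * k * B₁) ^ m) * M m *
            (m.factorial / (j.factorial * (m - j).factorial)) := by
              field_simp
        _ = _ := by rw [← mul_pow, Nat.cast_choose ℝ hjm]; ring
    calc ‖powComp k g m t‖ ≤ ∑ j ∈ Finset.range (m + 1),
          A * (32 * k ^ 2 * B₁) ^ m * M m * (m.choose j : ℝ) := norm_sum_le_of_le _ hterm
      _ = A * (32 * k ^ 2 * B₁) ^ m * M m * 2 ^ m := by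
          rw [← Finset.mul_sum, ← Nat.cast_sum, Nat.sum_range_choose]; push_cast; rfl
      _ = A * ((32 * k ^ 2 * B₁) ^ m * 2 ^ m) * M m := by ring
      _ = _ := by rw [← mul_pow]; ring
  have hzero := eq_zero_of_denjoyCarleman hM hmono hDC hA (B := 64 * k ^ 2 * B₁) (by positivity)
    (fun n x hx => powComp_hasDerivWithinAt (by omega) hδ hg n hx) hH (fun n => by
      refine Finset.sum_eq_zero fun j _ => ?_
      rw [zero_pow (n := k) (by omega), h0, smul_zero])
  refine ⟨δ ^ k, ⟨pow_pos hδ0 k, pow_le_of_le_one hδ0.le hδ (by omega)⟩, fun x hx => ?_⟩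
  have hroot : (x ^ ((k : ℝ)⁻¹)) ^ k = x := Real.rpow_inv_natCast_pow hx.1 (by omega)
  have := hzero (x ^ ((k : ℝ)⁻¹)) ⟨Real.rpow_nonneg hx.1 _,
    le_of_pow_le_pow_left₀ (n := k) (by omega) hδ0.le (hroot.le.trans hx.2)⟩
  simpa [powComp, powCompCoeff, hroot] using this

end Weight

/-! ### Enlarging a log-convex sequence -/

/-- Replacing the ratios `M (n + 1) / M n` of a log-convex sequence by their maximum with `n + 1`
makes `M n / n!` non-decreasing; by Cauchy condensation the Denjoy-Carleman condition is kept. -/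
lemma IsLogConvexSeq.exists_le_monotone_div_factorial {M : ℕ → ℝ} (hM : ∀ n, 0 < M n)
    (h : IsLogConvexSeq M) (hDC : DenjoyCarlemanCondition M) :
    ∃ M' : ℕ → ℝ, (∀ n, M n ≤ M' n) ∧ (Monotone fun n : ℕ => M' n / (n.factorial : ℝ)) ∧
      DenjoyCarlemanCondition M' := by
  set ν : ℕ → ℝ := fun n => max (M (n + 1) / M n) (n + 1) with hν
  have hνpos : ∀ n, 0 < ν n := fun n => lt_max_of_lt_left (div_pos (hM _) (hM _))
  have hνmono : Monotone ν := fun i j hij =>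
    max_le_max (h.ratio_monotone hM hij) (by have : (i : ℝ) ≤ j := by exact_mod_cast hij
                                             linarith)
  set M' : ℕ → ℝ := fun n => M 0 * ∏ i ∈ Finset.range n, ν i with hM'
  have hsucc : ∀ n, M' (n + 1) = M' n * ν n := fun n => by
    simp only [hM', Finset.prod_range_succ]; ring
  have hM'pos : ∀ n, 0 < M' n := fun n => mul_pos (hM 0) (Finset.prod_pos fun i _ => hνpos i)
  have hlc : IsLogConvexSeq M' := fun n => by
    rw [hsucc (n + 1), hsucc n]
    have h1 := hνmono (Nat.le_succ n)
    have h2 := hM'pos n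
    have h3 := hνpos n
    calc (M' n * ν n) ^ 2 = M' n * (M' n * ν n * ν n) := by ring
      _ ≤ M' n * (M' n * ν n * ν (n + 1)) := by gcongr
  refine ⟨M', fun n => ?_, monotone_nat_of_le_succ fun n => ?_, ?_⟩
  · induction n with
    | zero => simp [hM']
    | succ n ih =>
      rw [hsucc]
      calc M (n + 1) = M n * (M (n + 1) / M n) := by rw [mul_div_cancel₀ _ (hM n).ne']
        _ ≤ M' n * ν n := mul_le_mul ih (le_max_left _ _) (div_pos (hM _) (hM _)).le (hM'pos n).le
  · rw [div_le_div_iff₀ (by positivity) (by positivity), hsucc, Nat.factorial_succ]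
    have h1 : (n : ℝ) + 1 ≤ ν n := le_max_right _ _
    have h2 := hM'pos n
    push_cast
    calc M' n * (((n : ℝ) + 1) * n.factorial) ≤ M' n * (ν n * n.factorial) := by gcongr
      _ = _ := by ring
  · rw [DenjoyCarlemanCondition, hlc.logConvexMinorant_eq hM'pos,
      ← not_summable_iff_tendsto_nat_atTop_of_nonneg fun n => (div_pos (hM'pos _) (hM'pos _)).le]
    rw [DenjoyCarlemanCondition, h.logConvexMinorant_eq hM,
      ← not_summable_iff_tendsto_nat_atTop_of_nonneg fun n => (div_pos (hM _) (hM _)).le] at hDC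
    have hν' : ∀ n, M' n / M' (n + 1) = (ν n)⁻¹ := fun n => by
      rw [hsucc, div_mul_eq_div_div, div_self (hM'pos n).ne', one_div]
    have hb' : ∀ n, M n / M (n + 1) = (M (n + 1) / M n)⁻¹ := fun n => by rw [inv_div]
    simp only [hν']
    simp only [hb'] at hDC
    intro hsum
    apply hDC
    rw [← summable_condensed_iff_of_nonneg (fun n => (inv_pos.2 (hνpos n)).le)
      (fun m n _ hmn => inv_anti₀ (hνpos m) (hνmono hmn))] at hsum
    rw [← summable_condensed_iff_of_nonneg
      (fun n => (inv_pos.2 (div_pos (hM (n + 1)) (hM n))).le)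
      (fun m n _ hmn => inv_anti₀ (div_pos (hM _) (hM _)) (h.ratio_monotone hM hmn))]
    -- The condensed terms tend to zero, so the maximum with `2 ^ k + 1` is eventually inactive.
    have hev := hsum.tendsto_atTop_zero.eventually (gt_mem_nhds (show (0 : ℝ) < 1 / 2 by norm_num))
    refine hsum.congr_atTop ?_
    filter_upwards [hev] with k hk
    rcases max_choice (M (2 ^ k + 1) / M (2 ^ k)) (((2 ^ k : ℕ) : ℝ) + 1) with h1 | h1
    · simp only [hν, h1]
    · exfalso
      simp only [hν, h1] at hk
      push_cast at hk
      have h2 : (1 : ℝ) ≤ 2 ^ k := one_le_pow₀ one_le_two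
      rw [← div_eq_mul_inv, div_lt_div_iff₀ (by positivity) (by norm_num)] at hk
      linarith

/-! ### A flat function with prescribed derivative bounds -/

section Construction

/-- The average of `φ` over the window `[x - c, x]`. -/
noncomputable def windowAverage (c : ℝ) (φ : ℝ → ℝ) (x : ℝ) : ℝ :=
  ∫ s in (0 : ℝ)..1, φ (x - c * s)

/-- The indicator of `(0, ∞)` averaged successively over windows of lengths
`a (k + n - 1), …, a k`. -/
noncomputable def iteratedAverage (a : ℕ → ℝ) : ℕ → ℕ → ℝ → ℝ
  | 0, _ => Set.indicator (Set.Ioi 0) 1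
  | n + 1, k => windowAverage (a k) (iteratedAverage a n (k + 1))

variable {a : ℕ → ℝ}

lemma Monotone.intervalIntegrable_comp_sub_mul {φ : ℝ → ℝ} (hφ : Monotone φ) {c : ℝ} (hc : 0 ≤ c)
    (x : ℝ) : IntervalIntegrable (fun s => φ (x - c * s)) MeasureTheory.volume 0 1 := by
  refine Antitone.intervalIntegrable fun s t hst => hφ ?_
  have := mul_le_mul_of_nonneg_left hst hc
  linarith

lemma windowAverage_le_windowAverage {φ ψ : ℝ → ℝ} (hφ : Monotone φ) (hψ : Monotone ψ) {c : ℝ}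
    (hc : 0 ≤ c) {x y : ℝ} (h : ∀ s ∈ Set.Icc (0 : ℝ) 1, φ (x - c * s) ≤ ψ (y - c * s)) :
    windowAverage c φ x ≤ windowAverage c ψ y :=
  intervalIntegral.integral_mono_on zero_le_one (hφ.intervalIntegrable_comp_sub_mul hc x)
    (hψ.intervalIntegrable_comp_sub_mul hc y) h

lemma windowAverage_const (c y x : ℝ) : windowAverage c (fun _ => y) x = y := by
  simp [windowAverage]

lemma windowAverage_le_self {φ : ℝ → ℝ} (hφ : Monotone φ) {c : ℝ} (hc : 0 ≤ c) (x : ℝ) :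
    windowAverage c φ x ≤ φ x := by
  rw [← windowAverage_const c (φ x) x]
  refine windowAverage_le_windowAverage hφ monotone_const hc fun s hs => hφ ?_
  have := mul_nonneg hc hs.1
  linarith

lemma self_sub_le_windowAverage {φ : ℝ → ℝ} (hφ : Monotone φ) {c : ℝ} (hc : 0 ≤ c) (x : ℝ) :
    φ (x - c) ≤ windowAverage c φ x := by
  rw [← windowAverage_const c (φ (x - c)) x]
  refine windowAverage_le_windowAverage monotone_const hφ hc fun s hs => hφ ?_
  have := mul_le_mul_of_nonneg_left hs.2 hc
  linarith

lemma iteratedAverage_monotone (ha : ∀ n, 0 < a n) : ∀ n k, Monotone (iteratedAverage a n k)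
  | 0, _ => by
    intro x y hxy
    by_cases h : 0 < x
    · simp [iteratedAverage, h, h.trans_le hxy]
    · by_cases h' : 0 < y <;> simp [iteratedAverage, h, h']
  | n + 1, k => fun x y hxy =>
    windowAverage_le_windowAverage (iteratedAverage_monotone ha n (k + 1))
      (iteratedAverage_monotone ha n (k + 1)) (ha k).le fun s _ =>
        iteratedAverage_monotone ha n (k + 1) (by linarith)

lemma iteratedAverage_le_one (ha : ∀ n, 0 < a n) : ∀ n k x, iteratedAverage a n k x ≤ 1
  | 0, _, x => by
    by_cases h : 0 < x <;> simp [iteratedAverage, h]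
  | n + 1, k, x => (windowAverage_le_self (iteratedAverage_monotone ha n (k + 1)) (ha k).le x).trans
      (iteratedAverage_le_one ha n (k + 1) x)

lemma iteratedAverage_nonneg (ha : ∀ n, 0 < a n) : ∀ n k x, 0 ≤ iteratedAverage a n k x
  | 0, _, x => by
    by_cases h : 0 < x <;> simp [iteratedAverage, h]
  | n + 1, k, x => (iteratedAverage_nonneg ha n (k + 1) (x - a k)).trans
      (self_sub_le_windowAverage (iteratedAverage_monotone ha n (k + 1)) (ha k).le x)

lemma iteratedAverage_succ_le (ha : ∀ n, 0 < a n) :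
    ∀ n k x, iteratedAverage a (n + 1) k x ≤ iteratedAverage a n k x
  | 0, k, x => windowAverage_le_self (iteratedAverage_monotone ha 0 (k + 1)) (ha k).le x
  | n + 1, k, _ => windowAverage_le_windowAverage (iteratedAverage_monotone ha (n + 1) (k + 1))
      (iteratedAverage_monotone ha n (k + 1)) (ha k).le fun _ _ =>
        iteratedAverage_succ_le ha n (k + 1) _

lemma iteratedAverage_eq_one (ha : ∀ n, 0 < a n) :
    ∀ n k x, ∑ i ∈ Finset.range n, a (k + i) < x → iteratedAverage a n k x = 1
  | 0, _, x, h => by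
    have : 0 < x := by simpa using h
    simp [iteratedAverage, this]
  | n + 1, k, x, h => by
    refine le_antisymm (iteratedAverage_le_one ha (n + 1) k x) ?_
    rw [← iteratedAverage_eq_one ha n (k + 1) (x - a k)]
    · exact self_sub_le_windowAverage (iteratedAverage_monotone ha n (k + 1)) (ha k).le x
    · rw [Finset.sum_range_succ'] at h
      have e : ∀ i, a (k + (i + 1)) = a (k + 1 + i) := fun i => by congr 1; ring
      simp only [e, add_zero] at h
      linarith

lemma iteratedAverage_antitone (ha : ∀ n, 0 < a n) (k : ℕ) (x : ℝ) :
    Antitone fun n => iteratedAverage a n k x :=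
  antitone_nat_of_succ_le fun n => iteratedAverage_succ_le ha n k x

/-- The limit of the averages of the indicator of `(0, ∞)` over windows of lengths
`a k, a (k + 1), …`: the distribution function of `∑ a i * U i`, `i ≥ k`, for independent `U i`
uniformly distributed in `[0, 1]`. -/
noncomputable def infiniteAverage (a : ℕ → ℝ) (k : ℕ) (x : ℝ) : ℝ :=
  ⨅ n, iteratedAverage a n k x

lemma iteratedAverage_tendsto (ha : ∀ n, 0 < a n) (k : ℕ) (x : ℝ) :
    Filter.Tendsto (fun n => iteratedAverage a n k x) Filter.atTop (nhds (infiniteAverage a k x)) :=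
  tendsto_atTop_ciInf (iteratedAverage_antitone ha k x)
    ⟨0, by rintro _ ⟨n, rfl⟩; exact iteratedAverage_nonneg ha n k x⟩

lemma infiniteAverage_monotone (ha : ∀ n, 0 < a n) (k : ℕ) : Monotone (infiniteAverage a k) :=
  fun x y hxy => le_of_tendsto_of_tendsto' (iteratedAverage_tendsto ha k x)
    (iteratedAverage_tendsto ha k y) fun n => iteratedAverage_monotone ha n k hxy

lemma infiniteAverage_nonneg (ha : ∀ n, 0 < a n) (k : ℕ) (x : ℝ) : 0 ≤ infiniteAverage a k x :=
  ge_of_tendsto' (iteratedAverage_tendsto ha k x) fun n => iteratedAverage_nonneg ha n k x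

lemma infiniteAverage_le_one (ha : ∀ n, 0 < a n) (k : ℕ) (x : ℝ) : infiniteAverage a k x ≤ 1 :=
  le_of_tendsto' (iteratedAverage_tendsto ha k x) fun n => iteratedAverage_le_one ha n k x

lemma infiniteAverage_eq_zero (ha : ∀ n, 0 < a n) (k : ℕ) {x : ℝ} (hx : x ≤ 0) :
    infiniteAverage a k x = 0 := by
  refine le_antisymm ?_ (infiniteAverage_nonneg ha k x)
  have := (iteratedAverage_antitone ha k x).le_of_tendsto (iteratedAverage_tendsto ha k x) 0
  simpa [iteratedAverage, not_lt.2 hx] using this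

lemma infiniteAverage_eq_one (ha : ∀ n, 0 < a n) (hs : Summable a) {x : ℝ} (hx : ∑' n, a n < x) :
    infiniteAverage a 0 x = 1 := by
  refine tendsto_nhds_unique (iteratedAverage_tendsto ha 0 x) (tendsto_const_nhds.congr fun n => ?_)
  refine (iteratedAverage_eq_one ha n 0 x (lt_of_le_of_lt ?_ hx)).symm
  simpa using hs.sum_le_tsum (Finset.range n) fun i _ => (ha i).le

lemma infiniteAverage_eq_windowAverage (ha : ∀ n, 0 < a n) (k : ℕ) (x : ℝ) :
    infiniteAverage a k x = windowAverage (a k) (infiniteAverage a (k + 1)) x := by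
  refine tendsto_nhds_unique
    ((Filter.tendsto_add_atTop_iff_nat 1).2 (iteratedAverage_tendsto ha k x)) ?_
  refine intervalIntegral.tendsto_integral_filter_of_dominated_convergence (fun _ => (1 : ℝ))
    (Filter.Eventually.of_forall fun n => ?_) (Filter.Eventually.of_forall fun n => ?_)
    intervalIntegrable_const ?_
  · exact ((iteratedAverage_monotone ha n (k + 1)).measurable.comp
      (by fun_prop)).aestronglyMeasurable
  · refine Filter.Eventually.of_forall fun s _ => ?_
    rw [Real.norm_of_nonneg (iteratedAverage_nonneg ha n (k + 1) _)]
    exact iteratedAverage_le_one ha n (k + 1) _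
  · exact Filter.Eventually.of_forall fun s _ => iteratedAverage_tendsto ha (k + 1) _

lemma infiniteAverage_eq_sub (ha : ∀ n, 0 < a n) (k : ℕ) (x : ℝ) :
    infiniteAverage a k x = (a k)⁻¹ * ((∫ t in (0 : ℝ)..x, infiniteAverage a (k + 1) t) -
      ∫ t in (0 : ℝ)..(x - a k), infiniteAverage a (k + 1) t) := by
  have hint : ∀ u v, IntervalIntegrable (infiniteAverage a (k + 1)) MeasureTheory.volume u v :=
    fun u v => (infiniteAverage_monotone ha (k + 1)).intervalIntegrable
  rw [infiniteAverage_eq_windowAverage ha, windowAverage,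
    intervalIntegral.integral_comp_sub_mul _ (ha k).ne',
    intervalIntegral.integral_interval_sub_left (hint _ _) (hint _ _)]
  simp

lemma infiniteAverage_continuous (ha : ∀ n, 0 < a n) (k : ℕ) :
    Continuous (infiniteAverage a k) := by
  have h := intervalIntegral.continuous_primitive (μ := MeasureTheory.volume)
    (fun u v => (infiniteAverage_monotone ha (k + 1)).intervalIntegrable) 0
  rw [funext (infiniteAverage_eq_sub ha k)]
  exact continuous_const.mul (h.sub (h.comp (continuous_id.sub continuous_const)))

lemma infiniteAverage_hasDerivAt (ha : ∀ n, 0 < a n) (k : ℕ) (x : ℝ) :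
    HasDerivAt (infiniteAverage a k)
      ((a k)⁻¹ * (infiniteAverage a (k + 1) x - infiniteAverage a (k + 1) (x - a k))) x := by
  have h : ∀ y, HasDerivAt (fun x => ∫ t in (0 : ℝ)..x, infiniteAverage a (k + 1) t)
      (infiniteAverage a (k + 1) y) y := fun y =>
    ((infiniteAverage_continuous ha (k + 1)).integral_hasStrictDerivAt 0 y).hasDerivAt
  rw [funext (infiniteAverage_eq_sub ha k)]
  exact ((h x).sub ((h (x - a k)).comp_sub_const x (a k))).const_mul _

lemma infiniteAverage_deriv (ha : ∀ n, 0 < a n) (k : ℕ) :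
    deriv (infiniteAverage a k) = fun x =>
      (a k)⁻¹ * (infiniteAverage a (k + 1) x - infiniteAverage a (k + 1) (x - a k)) :=
  funext fun x => (infiniteAverage_hasDerivAt ha k x).deriv

lemma infiniteAverage_contDiff_nat (ha : ∀ n, 0 < a n) :
    ∀ n k : ℕ, ContDiff ℝ n (infiniteAverage a k)
  | 0, k => contDiff_zero.2 (infiniteAverage_continuous ha k)
  | n + 1, k => by
    have h := infiniteAverage_contDiff_nat ha n (k + 1)
    push_cast
    rw [contDiff_succ_iff_deriv, infiniteAverage_deriv ha]
    refine ⟨fun x => (infiniteAverage_hasDerivAt ha k x).differentiableAt, by simp, ?_⟩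
    exact contDiff_const.mul (h.sub (h.comp (contDiff_id.sub contDiff_const)))

lemma infiniteAverage_contDiff (ha : ∀ n, 0 < a n) (k : ℕ) : ContDiff ℝ ∞ (infiniteAverage a k) :=
  contDiff_infty.2 fun n => infiniteAverage_contDiff_nat ha n k

lemma abs_iteratedDeriv_infiniteAverage_le (ha : ∀ n, 0 < a n) :
    ∀ n k x, |iteratedDeriv n (infiniteAverage a k) x| ≤ ∏ i ∈ Finset.range n, 2 / a (k + i)
  | 0, k, x => by
    rw [iteratedDeriv_zero, abs_of_nonneg (infiniteAverage_nonneg ha k x)]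
    simpa using infiniteAverage_le_one ha k x
  | n + 1, k, x => by
    have h := infiniteAverage_contDiff_nat ha n (k + 1)
    have ih := abs_iteratedDeriv_infiniteAverage_le ha n (k + 1)
    have h' : ContDiff ℝ n fun x => infiniteAverage a (k + 1) (x - a k) :=
      h.comp (contDiff_id.sub contDiff_const)
    rw [iteratedDeriv_succ', infiniteAverage_deriv ha, iteratedDeriv_const_mul_field,
      iteratedDeriv_fun_sub h.contDiffAt h'.contDiffAt, iteratedDeriv_comp_sub_const, abs_mul,
      abs_of_pos (inv_pos.2 (ha k)), Finset.prod_range_succ']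
    have e : ∀ i, a (k + (i + 1)) = a (k + 1 + i) := fun i => by congr 1; ring
    simp only [e, add_zero]
    have h1 := (abs_sub _ _).trans (add_le_add (ih x) (ih (x - a k)))
    have := ha k
    calc (a k)⁻¹ * _ ≤ (a k)⁻¹ * _ := mul_le_mul_of_nonneg_left h1 (inv_pos.2 this).le
      _ = _ := by ring

end Construction

/-! ### Quasianalyticity under the Denjoy-Carleman condition -/

section Sufficiency

lemma Set.OrdConnected.uniqueDiffOn {I : Set ℝ} (hI : I.OrdConnected) (hI' : I.Nontrivial) :
    UniqueDiffOn ℝ I := by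
  obtain ⟨u, hu, v, hv, huv⟩ := hI'.exists_lt
  refine uniqueDiffOn_convex hI.convex ⟨(u + v) / 2, ?_⟩
  refine interior_mono (hI.out hu hv) ?_
  rw [interior_Icc]
  constructor <;> linarith

variable {E : Type*} [NormedAddCommGroup E] [NormedSpace ℝ E] {I : Set ℝ} {G : ℕ → ℝ → E}

/-- The successive derivatives of `t ↦ G 0 (x₀ + σ * t)`. With `σ = ±1` this reduces statements at
`x₀` to the left end of an interval `[0, T]`. -/
lemma HasDerivWithinAt.signed_comp
    (hG : ∀ n, ∀ x ∈ I, HasDerivWithinAt (G n) (G (n + 1) x) I x) {x₀ σ T : ℝ}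
    (hmaps : ∀ t ∈ Set.Icc 0 T, x₀ + σ * t ∈ I) (n : ℕ) {t : ℝ} (ht : t ∈ Set.Icc 0 T) :
    HasDerivWithinAt (fun t => σ ^ n • G n (x₀ + σ * t)) (σ ^ (n + 1) • G (n + 1) (x₀ + σ * t))
      (Set.Icc 0 T) t := by
  have h1 : HasDerivWithinAt (fun t => x₀ + σ * t) σ (Set.Icc 0 T) t := by
    simpa using ((hasDerivAt_id t).const_mul σ).const_add x₀ |>.hasDerivWithinAt
  have h2 := ((hG n _ (hmaps t ht)).scomp t h1 hmaps).const_smul (σ ^ n)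
  refine h2.congr_deriv ?_
  rw [smul_smul, pow_succ]

/-- All derivatives vanish on an interval on which the function vanishes. -/
lemma eq_zero_on_Icc_of_hasDerivWithinAt
    (hG : ∀ n, ∀ x ∈ I, HasDerivWithinAt (G n) (G (n + 1) x) I x) {u v : ℝ} (huv : u < v)
    (hI : Set.Icc u v ⊆ I) (h0 : ∀ x ∈ Set.Icc u v, G 0 x = 0) (n : ℕ) :
    ∀ x ∈ Set.Icc u v, G n x = 0 := by
  induction n with
  | zero => exact h0
  | succ n ih =>
    intro x hx
    have h1 := (hG n x (hI hx)).mono hI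
    have h2 : HasDerivWithinAt (G n) 0 (Set.Icc u v) x :=
      (hasDerivWithinAt_const x (Set.Icc u v) (0 : E)).congr (fun y hy => ih y hy) (ih x hx)
    exact (uniqueDiffOn_Icc huv x hx).eq_deriv _ h1 h2

variable {M : ℕ → ℝ} {a : ℝ}

/-- Between two points on the same side of the origin the weight is bounded, and the unweighted
theorem applies, with the orientation `σ = ±1` of the interval from `x₀` to `y`. -/
lemma eq_zero_of_same_side (hM : ∀ n, 0 < M n)
    (hmono : Monotone fun n : ℕ => M n / (n.factorial : ℝ)) (hDC : DenjoyCarlemanCondition M)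
    (ha0 : 0 ≤ a) (ha1 : a < 1) (hI : I.OrdConnected)
    (hG : ∀ n, ∀ x ∈ I, HasDerivWithinAt (G n) (G (n + 1) x) I x)
    (hbd : ∀ K ⊆ I, IsCompact K → ∃ A B : ℝ, 0 < A ∧ 0 < B ∧ ∀ x ∈ K \ {0}, ∀ n : ℕ,
      ‖G n x‖ ≤ A * B ^ n * (M n / |x| ^ (a * (n : ℝ))))
    {x₀ y : ℝ} (hx₀ : x₀ ∈ I) (hy : y ∈ I) (hxy : 0 < x₀ * y) (hflat : ∀ n, G n x₀ = 0) :
    G 0 y = 0 := by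
  obtain ⟨A, B, hA, hB, hAB⟩ := hbd (Set.uIcc x₀ y) (hI.uIcc_subset hx₀ hy) isCompact_uIcc
  obtain ⟨σ, hσ, hσy⟩ : ∃ σ : ℝ, |σ| = 1 ∧ y - x₀ = σ * |y - x₀| := by
    rcases le_total 0 (y - x₀) with h | h
    · exact ⟨1, by simp, by rw [abs_of_nonneg h, one_mul]⟩
    · exact ⟨-1, by simp, by rw [abs_of_nonpos h]; ring⟩
  set T := |y - x₀| with hT
  have hmem : ∀ t ∈ Set.Icc 0 T, x₀ + σ * t ∈ Set.uIcc x₀ y := by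
    intro t ht
    rw [Set.mem_uIcc]
    rcases (abs_eq zero_le_one).1 hσ with rfl | rfl
    · left; constructor <;> linarith [ht.1, ht.2]
    · right; constructor <;> linarith [ht.1, ht.2]
  have hx0' : x₀ ≠ 0 := left_ne_zero_of_mul hxy.ne'
  have hy0' : y ≠ 0 := right_ne_zero_of_mul hxy.ne'
  set m := min 1 (min |x₀| |y|) with hm
  have hm0 : 0 < m := lt_min one_pos (lt_min (abs_pos.2 hx0') (abs_pos.2 hy0'))
  have hlow : ∀ x ∈ Set.uIcc x₀ y, m ≤ |x| := by
    intro x hx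
    refine (min_le_right _ _).trans ?_
    rcases pos_and_pos_or_neg_and_neg_of_mul_pos hxy with ⟨h1, h2⟩ | ⟨h1, h2⟩
    · rw [abs_of_pos h1, abs_of_pos h2]
      exact (Set.mem_Icc.1 hx).1.trans (le_abs_self x)
    · rw [abs_of_neg h1, abs_of_neg h2, min_neg_neg]
      exact (neg_le_neg (Set.mem_Icc.1 hx).2).trans (neg_le_abs x)
  have hbound : ∀ n, ∀ t ∈ Set.Icc 0 T,
      ‖σ ^ n • G n (x₀ + σ * t)‖ ≤ A * (B / m) ^ n * M n := by
    intro n t ht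
    have hxm := hlow _ (hmem t ht)
    set x := x₀ + σ * t
    have hx0 : x ≠ 0 := abs_pos.1 (hm0.trans_le hxm)
    have hMn := hM n
    have hpow : m ^ n ≤ |x| ^ (a * (n : ℝ)) := by
      have hn : (0 : ℝ) ≤ a * n := by positivity
      calc m ^ n = m ^ (n : ℝ) := (Real.rpow_natCast m n).symm
        _ ≤ m ^ (a * (n : ℝ)) := Real.rpow_le_rpow_of_exponent_ge hm0 (min_le_left _ _)
            (mul_le_of_le_one_left (Nat.cast_nonneg n) ha1.le)
        _ ≤ _ := Real.rpow_le_rpow hm0.le hxm hn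
    rw [norm_smul, norm_pow, Real.norm_eq_abs, hσ, one_pow, one_mul]
    calc ‖G n x‖ ≤ A * B ^ n * (M n / |x| ^ (a * (n : ℝ))) := hAB x ⟨hmem t ht, hx0⟩ n
      _ ≤ A * B ^ n * (M n / m ^ n) := by gcongr
      _ = _ := by rw [div_pow]; ring
  have := eq_zero_of_denjoyCarleman hM hmono hDC hA (div_pos hB hm0)
    (fun n t ht => HasDerivWithinAt.signed_comp hG
      (fun t ht => hI.uIcc_subset hx₀ hy (hmem t ht)) n ht) hbound
    (fun n => by simp [hflat]) T ⟨abs_nonneg _, le_rfl⟩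
  rw [← hσy] at this
  simpa using this

/-- If all derivatives vanish at `0`, they all vanish at a point on the same side of `0` as `y`. -/
lemma exists_flat_point_of_flat_zero (hM : ∀ n, 0 < M n)
    (hmono : Monotone fun n : ℕ => M n / (n.factorial : ℝ)) (hDC : DenjoyCarlemanCondition M)
    (ha1 : a < 1) (hI : I.OrdConnected)
    (hG : ∀ n, ∀ x ∈ I, HasDerivWithinAt (G n) (G (n + 1) x) I x)
    (hbd : ∀ K ⊆ I, IsCompact K → ∃ A B : ℝ, 0 < A ∧ 0 < B ∧ ∀ x ∈ K \ {0}, ∀ n : ℕ,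
      ‖G n x‖ ≤ A * B ^ n * (M n / |x| ^ (a * (n : ℝ))))
    {y : ℝ} (h0I : (0 : ℝ) ∈ I) (hy : y ∈ I) (hy0 : y ≠ 0) (hflat : ∀ n, G n 0 = 0) :
    ∃ z ∈ I, 0 < z * y ∧ ∀ n, G n z = 0 := by
  obtain ⟨A, B, hA, hB, hAB⟩ := hbd (Set.uIcc 0 y) (hI.uIcc_subset h0I hy) isCompact_uIcc
  obtain ⟨σ, hσ, hσy⟩ : ∃ σ : ℝ, |σ| = 1 ∧ y = σ * |y| := by
    rcases le_total 0 y with h | h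
    · exact ⟨1, by simp, by rw [abs_of_nonneg h, one_mul]⟩
    · exact ⟨-1, by simp, by rw [abs_of_nonpos h]; ring⟩
  have hσσ : σ * σ = 1 := by rw [← abs_mul_abs_self, hσ, one_mul]
  set δ := min |y| 1 with hδ
  have hδ0 : 0 < δ := lt_min (abs_pos.2 hy0) one_pos
  have hδy : δ ≤ |y| := min_le_left _ _
  have hmem : ∀ t ∈ Set.Icc 0 δ, 0 + σ * t ∈ Set.uIcc 0 y := by
    intro t ht
    rw [Set.mem_uIcc]
    rcases (abs_eq zero_le_one).1 hσ with rfl | rfl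
    · left; constructor <;> linarith [ht.1, ht.2]
    · right; constructor <;> linarith [ht.1, ht.2]
  have hmemI : ∀ t ∈ Set.Icc 0 δ, 0 + σ * t ∈ I := fun t ht =>
    hI.uIcc_subset h0I hy (hmem t ht)
  have hder := fun (n : ℕ) (t : ℝ) (ht : t ∈ Set.Icc 0 δ) =>
    HasDerivWithinAt.signed_comp hG hmemI n ht
  obtain ⟨η, hη, hzero⟩ := eq_zero_of_denjoyCarleman_of_weight hM hmono hDC ha1 hδ0
    (min_le_right _ _) hA hB hder (fun n t ht => by
      have habs : |0 + σ * t| = t := by rw [zero_add, abs_mul, hσ, one_mul, abs_of_pos ht.1]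
      have hne : 0 + σ * t ≠ 0 := abs_pos.1 (by rw [habs]; exact ht.1)
      have := hAB _ ⟨hmem t ⟨ht.1.le, ht.2⟩, hne⟩ n
      rw [norm_smul, norm_pow, Real.norm_eq_abs, hσ, one_pow, one_mul]
      rwa [habs] at this) (fun n => by simp [hflat])
  have hall := eq_zero_on_Icc_of_hasDerivWithinAt (I := Set.Icc 0 δ) hder hη.1
    (Set.Icc_subset_Icc_right hη.2) hzero
  refine ⟨0 + σ * η, hmemI η ⟨hη.1.le, hη.2⟩, ?_, fun n => ?_⟩
  · rw [hσy]
    have : 0 < |y| := abs_pos.2 hy0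
    calc (0 : ℝ) < η * |y| := mul_pos hη.1 this
      _ = (σ * σ) * (η * |y|) := by rw [hσσ, one_mul]
      _ = _ := by ring
  · have hσ0 : σ ≠ 0 := left_ne_zero_of_mul (hσσ.trans_ne one_ne_zero)
    exact (smul_eq_zero_iff_right (pow_ne_zero n hσ0)).1 (hall n η ⟨hη.1.le, le_rfl⟩)

theorem isQuasianalytic_of_monotone {𝕜 : Type*} [RCLike 𝕜] (hI : I.OrdConnected)
    (hI' : I.Nontrivial) (hM : ∀ n, 0 < M n) (ha0 : 0 ≤ a) (ha1 : a < 1)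
    (hmono : Monotone fun n : ℕ => M n / (n.factorial : ℝ)) (hDC : DenjoyCarlemanCondition M) :
    IsQuasianalytic I (carlemanClass 𝕜 M a I) := by
  rintro f ⟨hf, hbd⟩ ⟨x₀, hx₀, hflat⟩ y hy
  have hu : UniqueDiffOn ℝ I := hI.uniqueDiffOn hI'
  set G : ℕ → ℝ → 𝕜 := fun n => iteratedDerivWithin n f I with hGdef
  have hG : ∀ n, ∀ x ∈ I, HasDerivWithinAt (G n) (G (n + 1) x) I x := fun n x hx => by
    have h := (hf.differentiableOn_iteratedDerivWithin (m := n)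
      (by exact_mod_cast WithTop.coe_lt_top _) hu) x hx
    have := h.hasDerivWithinAt
    rwa [← iteratedDerivWithin_succ] at this
  have hG0 : ∀ x, G 0 x = f x := fun x => by rw [hGdef]; simp
  rw [← hG0]
  -- Vanishing of all derivatives at `x ≠ 0` spreads to the points on the same side of the origin.
  have hside : ∀ x ∈ I, (∀ n, G n x = 0) → ∀ z ∈ I, 0 < x * z → G 0 z = 0 :=
    fun x hx hfx z hz hxz => eq_zero_of_same_side hM hmono hDC ha0 ha1 hI hG hbd hx hz hxz hfx
  have hfromzero : (0 : ℝ) ∈ I → (∀ n, G n 0 = 0) → G 0 y = 0 := by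
    intro h0I hf0
    rcases eq_or_ne y 0 with rfl | hy0
    · exact hf0 0
    obtain ⟨z, hz, hzy, hfz⟩ :=
      exists_flat_point_of_flat_zero hM hmono hDC ha1 hI hG hbd h0I hy hy0 hf0
    exact hside z hz hfz y hy hzy
  rcases eq_or_ne x₀ 0 with rfl | hx0
  · exact hfromzero hx₀ hflat
  rcases lt_or_ge 0 (x₀ * y) with hxy | hxy
  · exact hside x₀ hx₀ hflat y hy hxy
  have h0mem : (0 : ℝ) ∈ Set.uIcc x₀ y := by
    rw [Set.mem_uIcc]
    rcases mul_nonpos_iff.1 hxy with h | h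
    · exact Or.inr ⟨h.2, h.1⟩
    · exact Or.inl h
  have h0I : (0 : ℝ) ∈ I := hI.uIcc_subset hx₀ hy h0mem
  have hseg : Set.uIcc 0 x₀ ⊆ I := hI.uIcc_subset h0I hx₀
  have hne : ∀ x ∈ Set.uIcc 0 x₀, x ≠ 0 → G 0 x = 0 := by
    intro x hx hx0'
    refine hside x₀ hx₀ hflat x (hseg hx) ?_
    rw [Set.mem_uIcc] at hx
    rcases hx with h | h
    · have := h.1.lt_of_ne hx0'.symm
      exact mul_pos (this.trans_le h.2) this
    · have := h.2.lt_of_ne hx0'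
      exact mul_pos_of_neg_of_neg (h.1.trans_lt this) this
  have hpt : ∀ n : ℕ, x₀ * (1 / ((n : ℝ) + 1)) ∈ Set.uIcc 0 x₀ := fun n => by
    have h1 : (0 : ℝ) ≤ 1 / ((n : ℝ) + 1) := by positivity
    have h2 : 1 / ((n : ℝ) + 1) ≤ 1 := by
      rw [div_le_one (by positivity)]; linarith [(Nat.cast_nonneg n : (0 : ℝ) ≤ n)]
    rw [Set.mem_uIcc]
    rcases le_total 0 x₀ with h | h
    · left; constructor <;> nlinarith
    · right; constructor <;> nlinarith
  have hG00 : G 0 0 = 0 := by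
    have hlim : Filter.Tendsto (fun n : ℕ => x₀ * (1 / ((n : ℝ) + 1))) Filter.atTop
        (nhdsWithin 0 I) := by
      refine tendsto_nhdsWithin_iff.2 ⟨?_, Filter.Eventually.of_forall fun n => hseg (hpt n)⟩
      simpa using tendsto_one_div_add_atTop_nhds_zero_nat.const_mul x₀
    have h1 := ((hG 0 0 h0I).continuousWithinAt).tendsto.comp hlim
    refine tendsto_nhds_unique h1 (tendsto_const_nhds.congr fun n => ?_)
    exact (hne _ (hpt n) (mul_ne_zero hx0 (by positivity))).symm
  refine hfromzero h0I fun n => ?_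
  have hlt : min 0 x₀ < max 0 x₀ := min_lt_max.2 hx0.symm
  refine eq_zero_on_Icc_of_hasDerivWithinAt hG hlt hseg (fun x hx => ?_) n 0
    ⟨min_le_left _ _, le_max_left _ _⟩
  rcases eq_or_ne x 0 with rfl | h
  · exact hG00
  · exact hne x hx h

end Sufficiency

/-! ### Failure of quasianalyticity when the series converges -/

section Necessity

variable {I : Set ℝ} {M : ℕ → ℝ} {a : ℝ}

lemma carlemanClass_mono {𝕜 : Type*} [RCLike 𝕜] {M' : ℕ → ℝ} (h : ∀ n, M n ≤ M' n) :
    carlemanClass 𝕜 M a I ⊆ carlemanClass 𝕜 M' a I := by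
  rintro f ⟨hf, hbd⟩
  refine ⟨hf, fun K hK hKc => ?_⟩
  obtain ⟨A, B, hA, hB, hAB⟩ := hbd K hK hKc
  refine ⟨A, B, hA, hB, fun x hx n => (hAB x hx n).trans ?_⟩
  have := Real.rpow_nonneg (abs_nonneg x) (a * (n : ℝ))
  have := h n
  gcongr

/-- A function that is flat at one point of `I` and equal to `1` at another, in the class of the
minorant without weight. -/
theorem not_isQuasianalytic_of_summable {𝕜 : Type*} [RCLike 𝕜] (hI : I.OrdConnected)
    (hI' : I.Nontrivial) (hM : ∀ n, 0 < M n) (ha0 : 0 ≤ a) (ha1 : a < 1)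
    (hpos : ∀ n, 0 < logConvexMinorant M n)
    (hs : Summable fun n => logConvexMinorant M n / logConvexMinorant M (n + 1)) :
    ¬ IsQuasianalytic I (carlemanClass 𝕜 M a I) := by
  set W := logConvexMinorant M with hW
  obtain ⟨u, hu, v, hv, huv⟩ := hI'.exists_lt
  have hud : UniqueDiffOn ℝ I := hI.uniqueDiffOn hI'
  set S := ∑' n, W n / W (n + 1) with hS
  have hS0 : 0 ≤ S := tsum_nonneg fun n => (div_pos (hpos _) (hpos _)).le
  set x₀ := (u + v) / 2 with hx₀
  -- The lengths of the windows add up to less than `v - x₀`.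
  set c := (v - x₀) / (S + 1) with hc
  have hvx : 0 < v - x₀ := by rw [hx₀]; linarith
  have hc0 : 0 < c := by positivity
  set b : ℕ → ℝ := fun n => c * (W n / W (n + 1)) with hb
  have hb0 : ∀ n, 0 < b n := fun n => mul_pos hc0 (div_pos (hpos _) (hpos _))
  have hbs : Summable b := hs.mul_left c
  have hbt : ∑' n, b n < v - x₀ := by
    rw [hb, tsum_mul_left, ← hS, hc, div_mul_eq_mul_div, div_lt_iff₀ (by positivity)]
    nlinarith
  set F : ℝ → ℝ := fun x => infiniteAverage b 0 (x - x₀) with hF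
  have hFs : ContDiff ℝ ∞ F :=
    (infiniteAverage_contDiff hb0 0).comp (contDiff_id.sub contDiff_const)
  set f : ℝ → 𝕜 := (RCLike.ofRealLI (K := 𝕜)) ∘ F with hf
  have hfs : ContDiff ℝ ∞ f := (RCLike.ofRealLI (K := 𝕜)).contDiff.comp hFs
  have hprod : ∀ n, ∏ i ∈ Finset.range n, 2 / b (0 + i) = (2 / c) ^ n * (W n / W 0) := by
    intro n
    induction n with
    | zero => simp [(hpos 0).ne']
    | succ n ih =>
      rw [Finset.prod_range_succ, ih, zero_add]
      have := (hpos n).ne'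
      have := (hpos (n + 1)).ne'
      have := (hpos 0).ne'
      simp only [hb, pow_succ]
      field_simp
  have hnorm : ∀ n x, ‖iteratedDeriv n f x‖ ≤ (2 / c) ^ n * (W n / W 0) := by
    intro n x
    have h1 : ‖iteratedDeriv n f x‖ = |iteratedDeriv n F x| := by
      rw [← norm_iteratedFDeriv_eq_norm_iteratedDeriv, hf,
        (RCLike.ofRealLI (K := 𝕜)).norm_iteratedFDeriv_comp_left (n := (n : ℕ∞ω))
          ((hFs.of_le (by exact_mod_cast le_top)).contDiffAt) le_rfl,
        norm_iteratedFDeriv_eq_norm_iteratedDeriv, Real.norm_eq_abs]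
    rw [h1, hF, iteratedDeriv_comp_sub_const, ← hprod]
    exact abs_iteratedDeriv_infiniteAverage_le hb0 n 0 _
  have hwithin : ∀ n, ∀ x ∈ I, iteratedDerivWithin n f I x = iteratedDeriv n f x := fun n x hx =>
    iteratedDerivWithin_eq_iteratedDeriv hud
      ((hfs.of_le (by exact_mod_cast le_top)).contDiffAt) hx
  intro hqa
  have hmem : f ∈ carlemanClass 𝕜 M a I := by
    refine ⟨hfs.contDiffOn, fun K hK hKc => ?_⟩
    obtain ⟨R, hR, hRK⟩ := hKc.isBounded.exists_pos_norm_le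
    have hR1 : 1 ≤ max 1 R := le_max_left _ _
    set R' := max 1 R
    have hW0 := hpos 0
    refine ⟨1 / W 0, 2 / c * R', by positivity, by positivity, fun x hx n => ?_⟩
    rw [hwithin n x (hK hx.1)]
    have hx0 : 0 < |x| := abs_pos.2 hx.2
    have hxR : |x| ≤ R' := (hRK x hx.1).trans (le_max_right _ _)
    have hpow : |x| ^ (a * (n : ℝ)) ≤ R' ^ n := by
      have hn : (0 : ℝ) ≤ a * n := by positivity
      calc |x| ^ (a * (n : ℝ)) ≤ R' ^ (a * (n : ℝ)) := Real.rpow_le_rpow hx0.le hxR hn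
        _ ≤ R' ^ (n : ℝ) := Real.rpow_le_rpow_of_exponent_le hR1
            (mul_le_of_le_one_left (Nat.cast_nonneg n) ha1.le)
        _ = R' ^ n := Real.rpow_natCast R' n
    have hxp : 0 < |x| ^ (a * (n : ℝ)) := Real.rpow_pos_of_pos hx0 _
    have hMn := hM n
    calc ‖iteratedDeriv n f x‖ ≤ (2 / c) ^ n * (W n / W 0) := hnorm n x
      _ ≤ (2 / c) ^ n * (M n / W 0) := by gcongr; exact logConvexMinorant_le hM n
      _ ≤ (2 / c) ^ n * (M n / W 0) * (R' ^ n / |x| ^ (a * (n : ℝ))) :=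
          le_mul_of_one_le_right (by positivity) ((one_le_div hxp).2 hpow)
      _ = _ := by rw [mul_pow]; ring
  have hflat : ∀ n, iteratedDerivWithin n f I u = 0 := by
    intro n
    rw [hwithin n u hu]
    have hev : f =ᶠ[nhds u] fun _ => (0 : 𝕜) := by
      have hux : u < x₀ := by rw [hx₀]; linarith
      filter_upwards [Iio_mem_nhds hux] with x hx
      have : F x = 0 := infiniteAverage_eq_zero hb0 0 (sub_nonpos.2 (le_of_lt hx))
      simp [hf, this]
    rw [hev.iteratedDeriv_eq n]
    simp
  have hfv := hqa f hmem ⟨u, hu, hflat⟩ v hv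
  have hFv : F v = 1 := infiniteAverage_eq_one hb0 hbs hbt
  simp [hf, hFv] at hfv

end Necessity

/-! ### The characterization -/

theorem theorem2 {𝕜 : Type*} [RCLike 𝕜] (I : Set ℝ) (hI : I.OrdConnected) (hI' : I.Nontrivial)
    (M : ℕ → ℝ) (hM : ∀ n, 0 < M n) (a : ℝ) (ha0 : 0 ≤ a) (ha1 : a < 1)
    (hreg : IsLogConvexSeq M ∨ Monotone (fun n : ℕ => M n / (n.factorial : ℝ))) :
    IsQuasianalytic I (carlemanClass 𝕜 M a I) ↔ DenjoyCarlemanCondition M := by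
  have hpos : ∀ n, 0 < logConvexMinorant M n := by
    rcases hreg with h | h
    · rw [h.logConvexMinorant_eq hM]; exact hM
    · obtain ⟨-, -, -, -, -, -, -, hpos⟩ := exists_contact_sequence hM h
      exact hpos
  constructor
  · intro hqa
    rw [DenjoyCarlemanCondition,
      ← not_summable_iff_tendsto_nat_atTop_of_nonneg fun n => (div_pos (hpos _) (hpos _)).le]
    exact fun hs => not_isQuasianalytic_of_summable hI hI' hM ha0 ha1 hpos hs hqa
  · intro hDC
    rcases hreg with h | h
    · obtain ⟨M', hMM', hmono, hDC'⟩ := h.exists_le_monotone_div_factorial hM hDC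
      have hqa := isQuasianalytic_of_monotone (𝕜 := 𝕜) hI hI'
        (fun n => (hM n).trans_le (hMM' n)) ha0 ha1 hmono hDC'
      exact fun f hf => hqa f (carlemanClass_mono hMM' hf)
    · exact isQuasianalytic_of_monotone hI hI' hM ha0 ha1 h hDC
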